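/- Two sources, $1$ and $2$, share a channel and are served one packet after another, without idling from time $0$ on, by repeating forever a finite pattern $P=[P_0,\dots,P_{K-1}]\in\{1,2\}^K$ in which both sources appear. Each packet is generated at the instant its transmission starts. Service times and packet drops are all mutually independent. A packet of source $n$ has a nonnegative service time with a common law of mean $s_n>0$ and finite variance $v_n$; it is dropped with probability $p_n\in[0,1)$ and otherwise received when its service ends. Let $\Delta_n(t)=t-g_n(t)$ be the age of source $n$, where $g_n(t)$ is the generation time of the freshest update of source $n$ received by time $t$ (with an arbitrary initial age $\Delta_n(0)\ge 0$), and let $\mathbb E[\Delta_n]$ be the mean age of information, i.e. the almost sure limit of $\frac1T\int_0^T\Delta_n(t)\,dt$ as $T\to\infty$. Let $\alpha_n\ge1$ be the number of appearances of source $n$ in $P$, and put $a=\alpha_2/\alpha_1$, $s=as_2+s_1$, $v=av_2+v_1$. Let $\boldsymbol r=(r_1,\dots,r_{\alpha_1})$ be the placement vector with respect to source $1$: $r_i$ is the number of source-$2$ transmissions between the $i$th and the $(i+1)$th transmissions of source $1$ (cyclically). Let $\boldsymbol l=(l_1,\dots,l_{\alpha_2})$ be the placement vector with respect to source $2$, defined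 likewise. Put $\tilde r(i)=\sum_{j=1}^{\alpha_1}\bigl(\sum_{k=j}^{j+i-1}r_k\bigr)^2$ and $\tilde l(i)=\sum_{j=1}^{\alpha_2}\bigl(\sum_{k=j}^{j+i-1}l_k\bigr)^2$, with indices read modulo $\alpha_1$ and $\alpha_2$, respectively. Then both limits exist almost surely and, with $0^0=1$, $$\mathbb E[\Delta_1]=\frac{1+p_1}{2(1-p_1)}s+\frac{v}{2s}+s_1+s_2^2\,\frac{(1-p_1)^2}{2s\alpha_1(1-p_1^{\alpha_1})}\sum_{i=1}^{\alpha_1}\bigl(\tilde r(i)-\alpha_1a^2i^2\bigr)p_1^{i-1},$$ $$\mathbb E[\Delta_2]=\frac{1+p_2}{2a(1-p_2)}s+\frac{v}{2s}+s_2+s_1^2\,\frac{a(1-p_2)^2}{2s\alpha_2(1-p_2^{\alpha_2})}\sum_{i=1}^{\alpha_2}\Bigl(\tilde l(i)-\frac{\alpha_2i^2}{a^2}\Bigr)p_2^{i-1}.$$ Moreover, for each $n$, if $p_n=0$ then the formula for $\mathbb E[\Delta_n]$ reduces to the no-drop expression $$\mathbb E[\Delta_n]=\frac{2s_n^2+4s_n\tilde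 s_n+q_n+\tilde q_n}{2(s_n+\tilde s_n)},$$ where $q_n=v_n+s_n^2$, and $\tilde s_n=\frac1{\alpha_n}\sum_{k=1}^{\alpha_n}\mathbb E[H_{n,k}]$, $\tilde q_n=\frac1{\alpha_n}\sum_{k=1}^{\alpha_n}\mathbb E[H_{n,k}^2]$, $H_{n,k}$ being the total service time of the packets transmitted strictly between the $k$th and the $(k+1)$th transmissions of source $n$. -/

import Mathlib

open MeasureTheory ProbabilityTheory Filter Topology

noncomputable section

/-- The source scheduled at the `k`-th transmission (`k = 0, 1, 2, …`) when the finite pattern `P`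
is repeated forever. -/
def sched {K N : ℕ} [NeZero K] (P : Fin K → Fin N) (k : ℕ) : Fin N := P (Fin.ofNat K k)

/-- `α_n`: the number of times that source `n` appears in the pattern `P`. -/
def appearances {K N : ℕ} (P : Fin K → Fin N) (n : Fin N) : ℕ :=
  (Finset.univ.filter fun k : Fin K => P k = n).card

/-- The index (in the infinite sequence of transmissions) of the `i`-th scheduling instance of
source `n`, counted from `i = 0`. -/
def instanceIndex {K N : ℕ} [NeZero K] (P : Fin K → Fin N) (n : Fin N) (i : ℕ) : ℕ :=
  Nat.nth (fun k => sched P k = n) i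

/-- Placement vector of the schedule with respect to source `n`: entry `i` (from `i = 0`) is the
number of scheduling instances of the other sources between the `i`-th and the `(i+1)`-th
scheduling instances of source `n`. Its entries are those with `i < appearances P n`. -/
def placement {K N : ℕ} [NeZero K] (P : Fin K → Fin N) (n : Fin N) (i : ℕ) : ℕ :=
  ((Finset.Ioo (instanceIndex P n i) (instanceIndex P n (i + 1))).filter
    fun k => sched P k ≠ n).card

/-- `r̃(i)`: the sum of the squares of the sums of `i` cyclically consecutive entries of the vector
`r 0, …, r (m - 1)`. -/
def cyclicSquareSum (m : ℕ) (r : ℕ → ℕ) (i : ℕ) : ℝ :=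
  ∑ j ∈ Finset.range m, (∑ k ∈ Finset.Ico j (j + i), (r (k % m) : ℝ)) ^ 2

/-- The probabilistic model. `S k` is the service time of the `k`-th transmitted packet and `X k`
tells whether that packet is received (`true`) or dropped (`false`). Packets are independent, the
service time of a packet is independent of its being dropped, a packet of source `n` has a
nonnegative service time of law `F n` with finite second moment, and it is dropped with
probability `p n`. -/
structure IsCyclicTransmission {K N : ℕ} [NeZero K] (P : Fin K → Fin N)
    {Ω : Type*} [MeasurableSpace Ω] (μ : Measure Ω)
    (F : Fin N → Measure ℝ) (p : Fin N → ℝ) (S : ℕ → Ω → ℝ) (X : ℕ → Ω → Bool) : Prop where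
  measurable_service : ∀ k, Measurable (S k)
  measurable_received : ∀ k, Measurable (X k)
  indep_packets : iIndepFun (fun k ω => (S k ω, X k ω)) μ
  indep_service_received : ∀ k, IndepFun (S k) (X k) μ
  service_law : ∀ k, HasLaw (S k) (F (sched P k)) μ
  service_nonneg : ∀ n, ∀ᵐ x ∂F n, 0 ≤ x
  service_memLp : ∀ n, MemLp (fun x : ℝ => x) 2 (F n)
  drop_prob : ∀ k, μ.real {ω | X k ω = false} = p (sched P k)

/-- The time at which the `k`-th packet is generated and its transmission starts; transmissions
follow each other without idling, so this is also the time at which transmission `k - 1` ends. -/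
def startTime {Ω : Type*} (S : ℕ → Ω → ℝ) (k : ℕ) (ω : Ω) : ℝ := ∑ j ∈ Finset.range k, S j ω

/-- `g_n(t)`: the generation time of the freshest update of source `n` that has been received by
time `t`. An initial update of age `δ n` is available at time `0`. -/
def freshest {K N : ℕ} [NeZero K] (P : Fin K → Fin N) {Ω : Type*}
    (S : ℕ → Ω → ℝ) (X : ℕ → Ω → Bool) (δ : Fin N → Ω → ℝ) (n : Fin N) (t : ℝ) (ω : Ω) : ℝ :=
  sSup (insert (-δ n ω) {g : ℝ | ∃ k, sched P k = n ∧ X k ω = true ∧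
    startTime S (k + 1) ω ≤ t ∧ g = startTime S k ω})

/-- The age of information `Δ_n(t) = t - g_n(t)` of source `n`. -/
def age {K N : ℕ} [NeZero K] (P : Fin K → Fin N) {Ω : Type*}
    (S : ℕ → Ω → ℝ) (X : ℕ → Ω → Bool) (δ : Fin N → Ω → ℝ) (n : Fin N) (t : ℝ) (ω : Ω) : ℝ :=
  t - freshest P S X δ n t ω

/-- `c` is the long-run time average of `f` on `[0, ∞)`. -/
def HasTimeAverage (f : ℝ → ℝ) (c : ℝ) : Prop :=
  (∀ T, 0 ≤ T → IntervalIntegrable f volume 0 T) ∧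
    Tendsto (fun T : ℝ => (1 / T) * ∫ t in (0 : ℝ)..T, f t) atTop (𝓝 c)

/-- `E[Δ_n] = c`: almost surely, the age process of source `n` has long-run time average `c`. -/
def HasMeanAoI {K N : ℕ} [NeZero K] (P : Fin K → Fin N) {Ω : Type*} [MeasurableSpace Ω]
    (μ : Measure Ω) (S : ℕ → Ω → ℝ) (X : ℕ → Ω → Bool) (δ : Fin N → Ω → ℝ) (n : Fin N)
    (c : ℝ) : Prop :=
  ∀ᵐ ω ∂μ, HasTimeAverage (fun t => age P S X δ n t ω) c

/-- `H_{n,i}`: the total service time of the packets transmitted strictly between the `i`-th and the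
`(i+1)`-th scheduling instances of source `n`. -/
def gapTime {K N : ℕ} [NeZero K] (P : Fin K → Fin N) {Ω : Type*} (S : ℕ → Ω → ℝ) (n : Fin N)
    (i : ℕ) (ω : Ω) : ℝ :=
  ∑ k ∈ Finset.Ioo (instanceIndex P n i) (instanceIndex P n (i + 1)), S k ω

/-- The moment `E[S̃_n ^ m]` of the time `S̃_n` between the end of a transmission of source `n` and
the beginning of the next one, the `α_n` gaps of the pattern being equally likely. -/
def gapMoment {K N : ℕ} [NeZero K] (P : Fin K → Fin N) {Ω : Type*} [MeasurableSpace Ω]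
    (μ : Measure Ω) (S : ℕ → Ω → ℝ) (n : Fin N) (m : ℕ) : ℝ :=
  (1 / (appearances P n : ℝ)) *
    ∑ i ∈ Finset.range (appearances P n), ∫ ω, gapTime P S n i ω ^ m ∂μ

/-- The mean age without packet drops,
`(2 s² + 4 s s̃ + q + q̃) / (2 (s + s̃))`, where `s`, `q` are the first two moments of the service
time of the source and `s̃`, `q̃` those of the time between its transmissions. -/
def noDropAoI (s q s' q' : ℝ) : ℝ :=
  (2 * s ^ 2 + 4 * s * s' + q + q') / (2 * (s + s'))

end

/-! ### Periodic sequences -/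

/-! Fix a source `n`. Let `R k` be its age at the start of transmission `k`, and let `B k` be `0` if
that transmission delivers a packet of source `n`, and `1` otherwise. Then `R (k + 1) = S k + B k *
R k`, and the age integrates to `S k * R k + S k ^ 2 / 2` over transmission `k`. The mean age is
therefore the ratio, per repetition of the pattern, of the growth of these integrals to the growth
of time (`hasTimeAverage_age`).

The growth of `∑ S k * R k` comes from the Poisson equation `c k = E[S k] + E[B k] * c (k + 1)`.
Telescoping `c k * R k` (`sum_mul_ageAtStart`) leaves the deterministic rate `∑ c (k + 1) * E[S k]`,
sums of orthogonal terms with bounded second moments, and a boundary term. The last two are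
negligible almost surely, by Rajchman's law and because `E[R k ^ 2]` is bounded
(`ae_tendsto_sum_mul_ageAtStart`).

With two sources, the pattern is cut into blocks, each a transmission of `n` followed by `r j`
transmissions of the other source `o`. The values `W j` of `c` just after the transmissions of `n`
satisfy `W j = g n + g o * r j + p * W (j + 1)`, where `g` is the mean service time. Centring `r` at
`a` and `W` at its mean turns the rate into cyclic autocorrelations of `r j - a` weighted by powers
of `p`. These autocorrelations are half the second differences of the window square sums, so
summation by parts produces the factor `(1 - p) ^ 2` and the terms `r̃(i) - α a² i²`
(`sum_block_cost`). Exchanging the sources gives the second formula. -/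

theorem Function.Periodic.prod_range_add {f : ℕ → ℝ} {K : ℕ} (hf : Function.Periodic f K) (k : ℕ) :
    ∏ i ∈ Finset.range K, f (k + i) = ∏ i ∈ Finset.range K, f i := by
  induction k with
  | zero => simp
  | succ k ih =>
    rw [← ih]
    rcases K with _ | K
    · simp
    · rw [Finset.prod_range_succ, Finset.prod_range_succ' (fun i => f (k + i))]
      have h1 : f (k + 1 + K) = f (k + 0) := by
        have := hf k
        rw [← add_assoc] at this
        rw [add_right_comm, this, add_zero]
      rw [h1]
      congr 1
      refine Finset.prod_congr rfl fun i _ => ?_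
      rw [add_assoc, add_comm 1 i]

theorem Function.Periodic.sum_range_add {f : ℕ → ℝ} {K : ℕ} (hf : Function.Periodic f K) (k : ℕ) :
    ∑ i ∈ Finset.range K, f (k + i) = ∑ i ∈ Finset.range K, f i := by
  induction k with
  | zero => simp
  | succ k ih =>
    rw [← ih]
    rcases K with _ | K
    · simp
    · rw [Finset.sum_range_succ, Finset.sum_range_succ' (fun i => f (k + i))]
      have h1 : f (k + 1 + K) = f (k + 0) := by
        have := hf k
        rw [← add_assoc] at this
        rw [add_right_comm, this, add_zero]
      rw [h1]
      congr 1
      refine Finset.sum_congr rfl fun i _ => ?_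
      rw [add_assoc, add_comm 1 i]

theorem Function.Periodic.sum_range_mul {f : ℕ → ℝ} {K : ℕ} (hf : Function.Periodic f K) (q : ℕ) :
    ∑ i ∈ Finset.range (q * K), f i = q * ∑ i ∈ Finset.range K, f i := by
  induction q with
  | zero => simp
  | succ q ih =>
    rw [Nat.succ_mul, Finset.sum_range_add, ih, hf.sum_range_add]
    push_cast
    ring

theorem Function.Periodic.exists_abs_le {f : ℕ → ℝ} {K : ℕ} (hK : K ≠ 0)
    (hf : Function.Periodic f K) : ∃ C, ∀ k, |f k| ≤ C := by
  refine ⟨∑ i ∈ Finset.range K, |f i|, fun k => ?_⟩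
  rw [← hf.map_mod_nat k]
  exact Finset.single_le_sum (f := fun i => |f i|) (fun i _ => abs_nonneg _)
    (Finset.mem_range.2 (Nat.mod_lt _ (Nat.pos_of_ne_zero hK)))

theorem sum_range_mul_eq_sum_residues (f : ℕ → ℝ) (K q : ℕ) :
    ∑ i ∈ Finset.range (q * K), f i
      = ∑ r ∈ Finset.range K, ∑ i ∈ Finset.range q, f (r + i * K) := by
  induction q with
  | zero => simp
  | succ q ih =>
    rw [Nat.succ_mul, Finset.sum_range_add, ih]
    simp only [Finset.sum_range_succ, Finset.sum_add_distrib]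
    congr 1
    exact Finset.sum_congr rfl fun r _ => by rw [add_comm]

/-- The solution of the periodic backward recursion `c k = h k + b k * c (k + 1)`. -/
theorem exists_periodic_backward_recursion {K : ℕ} {b h : ℕ → ℝ}
    (hb : Function.Periodic b K) (hh : Function.Periodic h K)
    (hρ : ∏ i ∈ Finset.range K, b i < 1) (hb0 : ∀ k, 0 ≤ b k) (hh0 : ∀ k, 0 ≤ h k) :
    ∃ c : ℕ → ℝ, Function.Periodic c K ∧ (∀ k, 0 ≤ c k) ∧ ∀ k, c k = h k + b k * c (k + 1) := by
  set ρ := ∏ i ∈ Finset.range K, b i with hρdef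
  have hρ' : 0 < 1 - ρ := by linarith
  -- `G k n` unrolls the recursion `n` times from `k` with terminal value `0`. Iterating over whole
  -- periods gives a geometric series of ratio `ρ`, hence the division by `1 - ρ`.
  set G : ℕ → ℕ → ℝ := fun k n =>
    ∑ m ∈ Finset.range n, h (k + m) * ∏ i ∈ Finset.range m, b (k + i) with hG
  have hb' : ∀ k i, b (k + K + i) = b (k + i) := fun k i => by
    rw [add_right_comm]; exact hb _
  have hh' : ∀ k i, h (k + K + i) = h (k + i) := fun k i => by
    rw [add_right_comm]; exact hh _
  refine ⟨fun k => G k K / (1 - ρ), fun k => ?_, fun k => ?_, fun k => ?_⟩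
  · simp only [hG, hb', hh']
  · exact div_nonneg (Finset.sum_nonneg fun m _ => mul_nonneg (hh0 _)
      (Finset.prod_nonneg fun i _ => hb0 _)) hρ'.le
  -- `G k (K + 1)` is computed twice, by splitting off its last term and its first term.
  · have e1 : G k (K + 1) = G k K + h k * ρ := by
      simp only [hG, Finset.sum_range_succ, hh k]
      rw [hb.prod_range_add]
    have e2 : G k (K + 1) = b k * G (k + 1) K + h k := by
      simp only [hG]
      rw [Finset.sum_range_succ', Finset.range_zero, Finset.prod_empty, add_zero, mul_one,
        Finset.mul_sum]
      congr 1
      refine Finset.sum_congr rfl fun m _ => ?_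
      have e : ∏ i ∈ Finset.range m, b (k + (i + 1)) = ∏ i ∈ Finset.range m, b (k + 1 + i) :=
        Finset.prod_congr rfl fun i _ => by rw [add_comm i 1, add_assoc]
      rw [Finset.prod_range_succ', e, add_comm m 1, ← add_assoc, add_zero]
      ring
    field_simp
    linarith

/-- A nonnegative sequence with `x (k + 1) ≤ h + b k * x k`, where `b` is periodic and contracts
over a period, is bounded. -/
theorem bounded_of_periodic_contraction {K : ℕ} (hK : K ≠ 0) {b x : ℕ → ℝ} {h : ℝ}
    (hb : Function.Periodic b K)
    (hρ : ∏ i ∈ Finset.range K, b i < 1) (hb0 : ∀ k, 0 ≤ b k) (hx0 : ∀ k, 0 ≤ x k)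
    (hh : 0 ≤ h) (hx : ∀ k, x (k + 1) ≤ h + b k * x k) : ∃ C, ∀ k, x k ≤ C := by
  obtain ⟨c, hcp, hc0, hc⟩ := exists_periodic_backward_recursion (h := fun _ => 1) hb
    (fun _ => rfl) hρ hb0 (fun _ => zero_le_one)
  obtain ⟨M, hM⟩ := hcp.exists_abs_le hK
  have hcM : ∀ k, c k ≤ M := fun k => (le_abs_self _).trans (hM k)
  have hc1 : ∀ k, 1 ≤ c k := fun k => by
    rw [hc k]; linarith [mul_nonneg (hb0 k) (hc0 (k + 1))]
  have hM1 : 1 ≤ M := (hc1 0).trans (hcM 0)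
  have hM0 : 0 < M := by linarith
  -- `c k * x k` is a Lyapunov function: since `b k * c (k + 1) = c k - 1`, a step changes it by at
  -- most `M * h - x k`. It cannot grow when `x k ≥ M * h`; otherwise its next value is at most `M *
  -- h + (M - 1) * (M * h) = M * (M * h)`.
  have key : ∀ k, c k * x k ≤ M * (M * h) + c 0 * x 0 := by
    intro k
    induction k with
    | zero => linarith [mul_nonneg hM0.le (mul_nonneg hM0.le hh)]
    | succ k ih =>
      have h1 : c (k + 1) * x (k + 1) ≤ c (k + 1) * h + (c k - 1) * x k := by
        have := mul_le_mul_of_nonneg_left (hx k) (hc0 (k + 1))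
        have e : (c k - 1) = b k * c (k + 1) := by rw [hc k]; ring
        rw [e]
        linarith
      have h2 : c (k + 1) * h ≤ M * h := mul_le_mul_of_nonneg_right (hcM _) hh
      have h0 : 0 ≤ c 0 * x 0 := mul_nonneg (hc0 0) (hx0 0)
      by_cases hxk : M * h ≤ x k
      · nlinarith
      · push Not at hxk
        have : c k * x k ≤ M * x k := mul_le_mul_of_nonneg_right (hcM k) (hx0 k)
        have : M * x k ≤ M * (M * h) := mul_le_mul_of_nonneg_left hxk.le hM0.le
        have h3 : (c k - 1) * x k ≤ (M - 1) * x k :=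
          mul_le_mul_of_nonneg_right (by linarith [hcM k]) (hx0 k)
        have h4 : (M - 1) * x k ≤ (M - 1) * (M * h) :=
          mul_le_mul_of_nonneg_left hxk.le (by linarith)
        nlinarith
  refine ⟨M * (M * h) + c 0 * x 0, fun k => le_trans ?_ (key k)⟩
  exact le_mul_of_one_le_left (hx0 k) (hc1 k)

/-! ### Averages along a subsequence -/

/-- The average of a monotone function converges if it does so along a sequence of times of linear
growth. -/
theorem tendsto_average_of_monotoneOn {J : ℝ → ℝ} (hJ : MonotoneOn J (Set.Ici 0)) (hJ0 : J 0 = 0)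
    {τ : ℕ → ℝ} (hτ : Monotone τ) (hτ0 : τ 0 = 0) {l c : ℝ} (hl : 0 < l)
    (hτl : Tendsto (fun q : ℕ => τ q / q) atTop (𝓝 l))
    (hJc : Tendsto (fun q : ℕ => J (τ q) / q) atTop (𝓝 c)) :
    Tendsto (fun T : ℝ => (1 / T) * J T) atTop (𝓝 (c / l)) := by
  have hτtop : Tendsto τ atTop atTop := by
    have h1 : Tendsto (fun q : ℕ => (q : ℝ) * (τ q / q)) atTop atTop :=
      tendsto_natCast_atTop_atTop.atTop_mul_pos hl hτl
    refine h1.congr' ?_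
    filter_upwards [eventually_gt_atTop 0] with q hq
    have : (q : ℝ) ≠ 0 := by positivity
    field_simp
  have hτnn : ∀ q, 0 ≤ τ q := fun q => hτ0 ▸ hτ (Nat.zero_le q)
  have hex : ∀ T : ℝ, ∃ q, T < τ q := fun T => (hτtop.eventually_gt_atTop T).exists
  classical
  -- For `T ≥ 0`, `m T` is the index with `τ (m T) ≤ T < τ (m T + 1)`.
  let m : ℝ → ℕ := fun T => Nat.find (hex T) - 1
  have hm1 : ∀ T, 0 ≤ T → Nat.find (hex T) = m T + 1 := by
    intro T hT
    have : Nat.find (hex T) ≠ 0 := by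
      intro h
      have := Nat.find_spec (hex T)
      rw [h, hτ0] at this
      linarith
    simp only [m]
    omega
  have hub : ∀ T, 0 ≤ T → T < τ (m T + 1) := fun T hT => by
    rw [← hm1 T hT]; exact Nat.find_spec (hex T)
  have hlb : ∀ T, 0 ≤ T → τ (m T) ≤ T := fun T hT => by
    have : m T < Nat.find (hex T) := by rw [hm1 T hT]; exact Nat.lt_succ_self _
    exact not_lt.1 (Nat.find_min (hex T) this)
  have hmtop : Tendsto m atTop atTop := by
    refine tendsto_atTop.2 fun k => ?_
    filter_upwards [eventually_ge_atTop (τ k), eventually_ge_atTop 0] with T hT hT0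
    by_contra hlt
    push Not at hlt
    exact absurd (hub T hT0) (not_lt.2 ((hτ hlt).trans hT))
  have hsucc : Tendsto (fun q : ℕ => ((q + 1 : ℕ) : ℝ) / q) atTop (𝓝 1) := by
    have : Tendsto (fun q : ℕ => (1 : ℝ) + 1 / (q : ℝ)) atTop (𝓝 (1 + 0)) :=
      tendsto_const_nhds.add tendsto_one_div_atTop_nhds_zero_nat
    rw [add_zero] at this
    refine this.congr' ?_
    filter_upwards [eventually_gt_atTop 0] with q hq
    have : (q : ℝ) ≠ 0 := by positivity
    push_cast
    field_simp
  have hτs : Tendsto (fun q : ℕ => τ (q + 1) / q) atTop (𝓝 l) := by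
    have := (hτl.comp (tendsto_add_atTop_nat 1)).mul hsucc
    rw [mul_one] at this
    refine this.congr fun q => ?_
    simp only [Function.comp]
    rw [div_mul_div_cancel₀ (by positivity)]
  have hJs : Tendsto (fun q : ℕ => J (τ (q + 1)) / q) atTop (𝓝 c) := by
    have := (hJc.comp (tendsto_add_atTop_nat 1)).mul hsucc
    rw [mul_one] at this
    refine this.congr fun q => ?_
    simp only [Function.comp]
    rw [div_mul_div_cancel₀ (by positivity)]
  -- With `m = m T`, the average at `T` lies between `J (τ m) / τ (m + 1)` and `J (τ (m + 1)) / τ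
  -- m`, which share the limit `c / l`.
  have hlow : Tendsto (fun q : ℕ => J (τ q) / τ (q + 1)) atTop (𝓝 (c / l)) := by
    refine (hJc.div hτs hl.ne').congr' ?_
    filter_upwards [eventually_gt_atTop 0] with q hq
    simp only [Pi.div_apply]
    rw [div_div_div_cancel_right₀ (by positivity)]
  have hupp : Tendsto (fun q : ℕ => J (τ (q + 1)) / τ q) atTop (𝓝 (c / l)) := by
    refine (hJs.div hτl hl.ne').congr' ?_
    filter_upwards [eventually_gt_atTop 0] with q hq
    simp only [Pi.div_apply]
    rw [div_div_div_cancel_right₀ (by positivity)]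
  have hJnn : ∀ T, 0 ≤ T → 0 ≤ J T := fun T hT =>
    hJ0 ▸ hJ (Set.mem_Ici.2 le_rfl) (Set.mem_Ici.2 hT) hT
  refine tendsto_of_tendsto_of_tendsto_of_le_of_le' (hlow.comp hmtop) (hupp.comp hmtop) ?_ ?_
  · filter_upwards [eventually_gt_atTop 0] with T hT
    simp only [Function.comp]
    rw [one_div_mul_eq_div]
    exact div_le_div₀ (hJnn T hT.le) (hJ (hτnn _) hT.le (hlb T hT.le)) hT (hub T hT.le).le
  · filter_upwards [eventually_gt_atTop 0, (hτtop.comp hmtop).eventually_gt_atTop 0] with T hT h2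
    simp only [Function.comp] at h2 ⊢
    rw [one_div_mul_eq_div]
    exact div_le_div₀ (hJnn _ (hτnn _)) (hJ hT.le (hτnn _) (hub T hT.le).le) h2 (hlb T hT.le)

/-! ### Sample paths: the age as a recursion with resets -/

noncomputable section

/-- The factor by which the end of transmission `k` multiplies the part of the age of source `n`
accumulated before that transmission: `0` if a packet of source `n` is received, `1` otherwise. -/
def resetFactor {K N : ℕ} [NeZero K] (P : Fin K → Fin N) {Ω : Type*} (X : ℕ → Ω → Bool)
    (n : Fin N) (k : ℕ) (ω : Ω) : ℝ :=
  if sched P k = n ∧ X k ω = true then 0 else 1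

/-- The age at the start of transmission `k`, for service times `S`, reset factors `B` and initial
age `x₀`. -/
def ageAtStart (S B : ℕ → ℝ) (x₀ : ℝ) : ℕ → ℝ
  | 0 => x₀
  | k + 1 => S k + B k * ageAtStart S B x₀ k

end

/-- The initial age enters linearly and is wiped out by the first reception. The probabilistic part
can thus start from age `0`, with no measurability asked of the initial age. -/
theorem ageAtStart_eq_add (S B : ℕ → ℝ) (x₀ : ℝ) (k : ℕ) :
    ageAtStart S B x₀ k = ageAtStart S B 0 k + x₀ * ∏ i ∈ Finset.range k, B i := by
  induction k with
  | zero => simp [ageAtStart]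
  | succ k ih =>
    rw [ageAtStart, ageAtStart, ih, Finset.prod_range_succ]
    ring

section Path

variable {K N : ℕ} [NeZero K] {P : Fin K → Fin N} {Ω : Type*} {S : ℕ → Ω → ℝ} {X : ℕ → Ω → Bool}
  {δ : Fin N → Ω → ℝ} {n : Fin N} {ω : Ω}

theorem startTime_succ (k : ℕ) : startTime S (k + 1) ω = startTime S k ω + S k ω :=
  Finset.sum_range_succ _ _

theorem startTime_monotone (hS : ∀ k, 0 ≤ S k ω) : Monotone fun k => startTime S k ω :=
  monotone_nat_of_le_succ fun k => by rw [startTime_succ]; linarith [hS k]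

theorem bddAbove_freshest (hS : ∀ k, 0 ≤ S k ω) (t : ℝ) :
    BddAbove (insert (-δ n ω) {g : ℝ | ∃ k, sched P k = n ∧ X k ω = true ∧
      startTime S (k + 1) ω ≤ t ∧ g = startTime S k ω}) := by
  refine BddAbove.insert _ ⟨t, ?_⟩
  rintro g ⟨k, -, -, hk, rfl⟩
  exact (startTime_monotone hS (Nat.le_succ k)).trans hk

theorem freshest_monotone (hS : ∀ k, 0 ≤ S k ω) :
    Monotone fun t => freshest P S X δ n t ω := by
  intro t t' htt'
  refine csSup_le_csSup (bddAbove_freshest hS t') (Set.insert_nonempty _ _) ?_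
  refine Set.insert_subset_insert ?_
  rintro g ⟨k, h1, h2, h3, h4⟩
  exact ⟨k, h1, h2, h3.trans htt', h4⟩

theorem freshest_le (hS : ∀ k, 0 ≤ S k ω) (hδ : 0 ≤ δ n ω) {t : ℝ} (ht : 0 ≤ t) :
    freshest P S X δ n t ω ≤ t := by
  refine csSup_le (Set.insert_nonempty _ _) ?_
  rintro g (rfl | ⟨k, -, -, hk, rfl⟩)
  · linarith
  · exact (startTime_monotone hS (Nat.le_succ k)).trans hk

theorem intervalIntegrable_age (hS : ∀ k, 0 ≤ S k ω) (x y : ℝ) :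
    IntervalIntegrable (fun t => age P S X δ n t ω) volume x y :=
  intervalIntegral.intervalIntegrable_id.sub
    ((freshest_monotone hS).monotoneOn _).intervalIntegrable

/-- Start times are monotone, so a reception at transmission `k` makes `startTime S k ω` the new
maximum; without one the set of candidates does not change. These are the two values of the reset
factor. -/
theorem isGreatest_freshest (hS : ∀ k, 0 ≤ S k ω) (hδ : 0 ≤ δ n ω) (k : ℕ) :
    IsGreatest (insert (-δ n ω) {g : ℝ | ∃ j, sched P j = n ∧ X j ω = true ∧
      j < k ∧ g = startTime S j ω})
      (startTime S k ω - ageAtStart (S · ω) (resetFactor P X n · ω) (δ n ω) k) := by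
  induction k with
  | zero => simp [startTime, ageAtStart]
  | succ k ih =>
    rw [startTime_succ, ageAtStart]
    have e : ∀ Bk x : ℝ, startTime S k ω + S k ω - (S k ω + Bk * x) = startTime S k ω - Bk * x :=
      fun Bk x => by ring
    rw [e]
    by_cases hk : sched P k = n ∧ X k ω = true
    · rw [resetFactor, if_pos hk, zero_mul, sub_zero]
      refine ⟨Or.inr ⟨k, hk.1, hk.2, Nat.lt_succ_self k, rfl⟩, ?_⟩
      rintro g (rfl | ⟨j, -, -, hj, rfl⟩)
      · have : 0 ≤ startTime S k ω := Finset.sum_nonneg fun i _ => hS i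
        linarith
      · exact startTime_monotone hS (Nat.lt_succ_iff.1 hj)
    · rw [resetFactor, if_neg hk, one_mul]
      convert ih using 3
      ext g
      constructor
      · rintro ⟨j, h1, h2, h3, h4⟩
        refine ⟨j, h1, h2, ?_, h4⟩
        rcases Nat.lt_succ_iff_lt_or_eq.1 h3 with h | rfl
        · exact h
        · exact absurd ⟨h1, h2⟩ hk
      · rintro ⟨j, h1, h2, h3, h4⟩
        exact ⟨j, h1, h2, h3.trans (Nat.lt_succ_self k), h4⟩

/-- On this half-open interval, the transmissions completed by time `t` are exactly those with index
below `k`. -/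
theorem age_eq (hS : ∀ k, 0 ≤ S k ω) (hδ : 0 ≤ δ n ω) {k : ℕ} {t : ℝ}
    (h1 : startTime S k ω ≤ t) (h2 : t < startTime S (k + 1) ω) :
    age P S X δ n t ω = t - startTime S k ω
      + ageAtStart (S · ω) (resetFactor P X n · ω) (δ n ω) k := by
  have h := (isGreatest_freshest (P := P) (X := X) hS hδ k).csSup_eq
  rw [age, freshest]
  have e : {g : ℝ | ∃ j, sched P j = n ∧ X j ω = true ∧ startTime S (j + 1) ω ≤ t ∧
      g = startTime S j ω} = {g : ℝ | ∃ j, sched P j = n ∧ X j ω = true ∧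
      j < k ∧ g = startTime S j ω} := by
    ext g
    constructor
    · rintro ⟨j, a, b, c, d⟩
      refine ⟨j, a, b, ?_, d⟩
      by_contra hj
      push Not at hj
      have := startTime_monotone hS (Nat.succ_le_succ hj)
      simp only [Nat.succ_eq_add_one] at this
      linarith
    · rintro ⟨j, a, b, c, d⟩
      exact ⟨j, a, b, (startTime_monotone hS (Nat.succ_le_of_lt c)).trans h1, d⟩
  rw [e, h]
  ring

theorem integral_age_transmission (hS : ∀ k, 0 ≤ S k ω) (hδ : 0 ≤ δ n ω) (k : ℕ) :
    ∫ t in startTime S k ω..startTime S (k + 1) ω, age P S X δ n t ω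
      = S k ω * ageAtStart (S · ω) (resetFactor P X n · ω) (δ n ω) k + S k ω ^ 2 / 2 := by
  have hle : startTime S k ω ≤ startTime S (k + 1) ω := startTime_monotone hS (Nat.le_succ k)
  -- Only the open interval is used, because the age may jump at the end of the transmission.
  rw [intervalIntegral.integral_congr_Ioo_of_le hle
    (g := fun t => t + (ageAtStart (S · ω) (resetFactor P X n · ω) (δ n ω) k - startTime S k ω))
    (fun t ht => by
      show age P S X δ n t ω = _
      rw [age_eq hS hδ ht.1.le ht.2]; ring)]
  rw [intervalIntegral.integral_add intervalIntegral.intervalIntegrable_id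
    intervalIntegrable_const, integral_id, intervalIntegral.integral_const, startTime_succ]
  simp only [smul_eq_mul]
  ring

theorem integral_age_startTime (hS : ∀ k, 0 ≤ S k ω) (hδ : 0 ≤ δ n ω) (m : ℕ) :
    ∫ t in (0 : ℝ)..startTime S m ω, age P S X δ n t ω
      = ∑ k ∈ Finset.range m,
        (S k ω * ageAtStart (S · ω) (resetFactor P X n · ω) (δ n ω) k + S k ω ^ 2 / 2) := by
  have h0 : startTime S 0 ω = 0 := by simp [startTime]
  rw [← h0, ← intervalIntegral.sum_integral_adjacent_intervals
    (a := fun k => startTime S k ω) (fun k _ => intervalIntegrable_age hS _ _)]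
  exact Finset.sum_congr rfl fun k _ => integral_age_transmission hS hδ k

/-- The age has a time average as soon as its integral over whole repetitions of the pattern grows
linearly. -/
theorem hasTimeAverage_age (hS : ∀ k, 0 ≤ S k ω) (hδ : 0 ≤ δ n ω) {l c : ℝ} (hl : 0 < l)
    (hτ : Tendsto (fun q : ℕ => startTime S (q * K) ω / q) atTop (𝓝 l))
    (hc : Tendsto (fun q : ℕ => (∑ k ∈ Finset.range (q * K),
        (S k ω * ageAtStart (S · ω) (resetFactor P X n · ω) (δ n ω) k + S k ω ^ 2 / 2)) / (q : ℝ))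
      atTop (𝓝 c)) :
    HasTimeAverage (fun t => age P S X δ n t ω) (c / l) := by
  refine ⟨fun T _ => intervalIntegrable_age hS _ _, ?_⟩
  refine tendsto_average_of_monotoneOn
    (J := fun T => ∫ t in (0 : ℝ)..T, age P S X δ n t ω)
    (τ := fun q => startTime S (q * K) ω) ?_ (by simp) ?_ (by simp [startTime]) hl hτ ?_
  · intro x hx y _ hxy
    refine intervalIntegral.integral_mono_interval le_rfl hx hxy ?_ (intervalIntegrable_age hS _ _)
    refine (ae_restrict_iff' measurableSet_Ioc).2 (ae_of_all _ fun t ht => ?_)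
    exact sub_nonneg.2 (freshest_le hS hδ ht.1.le)
  · exact fun i j hij => startTime_monotone hS (Nat.mul_le_mul_right K hij)
  · simpa only [integral_age_startTime hS hδ] using hc

end Path

/-! ### The past of the sequence of packets -/

section Past

/-- The information generated by the `σ`-algebras with index smaller than `k`. -/
abbrev pastSigma {Ω : Type*} (𝓖 : ℕ → MeasurableSpace Ω) (k : ℕ) : MeasurableSpace Ω := ⨆ j ∈ Set.Iio k, 𝓖 j

variable {Ω : Type*} {𝓖 : ℕ → MeasurableSpace Ω}

theorem pastSigma_mono {i j : ℕ} (h : i ≤ j) : pastSigma 𝓖 i ≤ pastSigma 𝓖 j :=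
  biSup_mono fun _ hk => lt_of_lt_of_le hk h

theorem le_pastSigma {i j : ℕ} (h : i < j) : 𝓖 i ≤ pastSigma 𝓖 j :=
  le_biSup 𝓖 (Set.mem_Iio.2 h)

end Past

/-! ### Laws of large numbers -/

section LLN

variable {Ω : Type*} [mΩ : MeasurableSpace Ω] {μ : Measure Ω}

/-- By Tonelli, `∑ f k` has finite integral, so it is finite almost everywhere and its terms tend to
zero. -/
theorem ae_tendsto_zero_of_summable_integral {f : ℕ → Ω → ℝ} (hf : ∀ k, Integrable (f k) μ)
    (hf0 : ∀ k ω, 0 ≤ f k ω) (hs : Summable fun k => ∫ ω, f k ω ∂μ) :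
    ∀ᵐ ω ∂μ, Tendsto (fun k => f k ω) atTop (𝓝 0) := by
  have hmeas : ∀ k, AEMeasurable (fun ω => ENNReal.ofReal (f k ω)) μ := fun k =>
    (hf k).aemeasurable.ennreal_ofReal
  have h1 : ∫⁻ ω, ∑' k, ENNReal.ofReal (f k ω) ∂μ ≠ ⊤ := by
    rw [lintegral_tsum hmeas]
    have : ∀ k, ∫⁻ ω, ENNReal.ofReal (f k ω) ∂μ = ENNReal.ofReal (∫ ω, f k ω ∂μ) := fun k =>
      (ofReal_integral_eq_lintegral_ofReal (hf k) (ae_of_all _ (hf0 k))).symm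
    simp only [this]
    exact hs.tsum_ofReal_ne_top
  filter_upwards [ae_lt_top' (AEMeasurable.tsum hmeas) h1] with ω hω
  have h2 := ENNReal.tendsto_atTop_zero_of_tsum_ne_top hω.ne
  have h3 := (ENNReal.tendsto_toReal ENNReal.zero_ne_top).comp h2
  simpa [Function.comp_def, ENNReal.toReal_ofReal (hf0 _ _)] using h3

theorem integral_sq_sum_eq_of_orthogonal {Z : ℕ → Ω → ℝ} (hZ : ∀ k, MemLp (Z k) 2 μ)
    (horth : ∀ i j, i < j → ∫ ω, Z i ω * Z j ω ∂μ = 0) (m : ℕ) :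
    ∫ ω, (∑ k ∈ Finset.range m, Z k ω) ^ 2 ∂μ = ∑ k ∈ Finset.range m, ∫ ω, Z k ω ^ 2 ∂μ := by
  induction m with
  | zero => simp
  | succ m ih =>
    have hsum : MemLp (fun ω => ∑ k ∈ Finset.range m, Z k ω) 2 μ :=
      memLp_finsetSum _ fun k _ => hZ k
    have hcross : ∫ ω, (∑ k ∈ Finset.range m, Z k ω) * Z m ω ∂μ = 0 := by
      simp only [Finset.sum_mul]
      have hi : ∀ k ∈ Finset.range m, Integrable (fun ω => Z k ω * Z m ω) μ :=
        fun k _ => (hZ k).integrable_mul (hZ m)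
      rw [integral_finsetSum _ hi]
      exact Finset.sum_eq_zero fun k hk => horth k m (Finset.mem_range.1 hk)
    have e : ∀ ω, (∑ k ∈ Finset.range (m + 1), Z k ω) ^ 2
        = (∑ k ∈ Finset.range m, Z k ω) ^ 2 + 2 * ((∑ k ∈ Finset.range m, Z k ω) * Z m ω)
          + Z m ω ^ 2 := fun ω => by rw [Finset.sum_range_succ]; ring
    simp only [e]
    have h1 : Integrable (fun ω => (∑ k ∈ Finset.range m, Z k ω) ^ 2) μ := hsum.integrable_sq
    have h2 : Integrable (fun ω => 2 * ((∑ k ∈ Finset.range m, Z k ω) * Z m ω)) μ :=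
      (hsum.integrable_mul (hZ m)).const_mul 2
    rw [integral_add (f := fun ω => (∑ k ∈ Finset.range m, Z k ω) ^ 2
        + 2 * ((∑ k ∈ Finset.range m, Z k ω) * Z m ω)) (h1.add h2) (hZ m).integrable_sq,
      integral_add h1 h2, integral_const_mul, hcross, ih, Finset.sum_range_succ]
    ring

theorem ae_tendsto_div_zero_of_bounded_sq {R : ℕ → Ω → ℝ} (hR2 : ∀ k, MemLp (R k) 2 μ) {C : ℝ}
    (hC : ∀ k, ∫ ω, R k ω ^ 2 ∂μ ≤ C) :
    ∀ᵐ ω ∂μ, Tendsto (fun m : ℕ => R m ω / m) atTop (𝓝 0) := by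
  have hsq : Summable fun r : ℕ => 1 / (r : ℝ) ^ 2 := Real.summable_one_div_nat_pow.2 one_lt_two
  have h := ae_tendsto_zero_of_summable_integral (μ := μ) (f := fun k ω => (R k ω / k) ^ 2)
    (fun k => by simp only [div_pow]; exact (hR2 k).integrable_sq.div_const _)
    (fun k ω => sq_nonneg _)
    (Summable.of_nonneg_of_le (fun k => integral_nonneg fun ω => sq_nonneg _) (fun k => by
      simp only [div_pow]
      rw [integral_div, div_eq_mul_one_div]
      exact mul_le_mul_of_nonneg_right (hC k) (by positivity)) (hsq.mul_left C))
  filter_upwards [h] with ω hω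
  have := hω.sqrt
  simp only [Real.sqrt_sq_eq_abs, Real.sqrt_zero] at this
  exact (tendsto_zero_iff_abs_tendsto_zero _).2 this

/-- Rajchman's strong law of large numbers: the averages of orthogonal random variables with
bounded second moments tend to zero. -/
theorem ae_tendsto_average_zero_of_orthogonal {Z : ℕ → Ω → ℝ} {C : ℝ}
    (hZ : ∀ k, MemLp (Z k) 2 μ) (horth : ∀ i j, i < j → ∫ ω, Z i ω * Z j ω ∂μ = 0)
    (hC : ∀ k, ∫ ω, Z k ω ^ 2 ∂μ ≤ C) :
    ∀ᵐ ω ∂μ, Tendsto (fun m : ℕ => (∑ k ∈ Finset.range m, Z k ω) / m) atTop (𝓝 0) := by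
  have hC0 : 0 ≤ C := (integral_nonneg fun ω => sq_nonneg _).trans (hC 0)
  -- `Q r` is the squared average at time `r²`. `V r` bounds, by Cauchy–Schwarz over at most `2r +
  -- 1` terms, the squared contribution of the times from `r²` to `(r + 1)²`, divided by `r⁴`. Their
  -- means are at most `C / r²` and `(2r + 1)² C / r⁴ ≤ 9C / r²`, both summable.
  let Q : ℕ → Ω → ℝ := fun r ω => (∑ k ∈ Finset.range (r ^ 2), Z k ω) ^ 2 / (r : ℝ) ^ 4
  let V : ℕ → Ω → ℝ := fun r ω =>
    ((2 * r + 1) * ∑ k ∈ Finset.Ico (r ^ 2) ((r + 1) ^ 2), Z k ω ^ 2) / (r : ℝ) ^ 4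
  have hQi : ∀ r, Integrable (Q r) μ := fun r =>
    (memLp_finsetSum (Finset.range (r ^ 2)) fun k _ => hZ k).integrable_sq.div_const _
  have hVi : ∀ r, Integrable (V r) μ := fun r =>
    ((integrable_finsetSum _ fun k _ => (hZ k).integrable_sq).const_mul _).div_const _
  have hsq : Summable fun r : ℕ => 1 / (r : ℝ) ^ 2 := Real.summable_one_div_nat_pow.2 one_lt_two
  have hQs : Summable fun r => ∫ ω, Q r ω ∂μ := by
    refine Summable.of_nonneg_of_le (fun r => integral_nonneg fun ω => by positivity)
      (fun r => ?_) (hsq.mul_left C)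
    simp only [Q]
    rw [integral_div, integral_sq_sum_eq_of_orthogonal hZ horth]
    rcases Nat.eq_zero_or_pos r with rfl | hr
    · simp
    have h1 : ∑ k ∈ Finset.range (r ^ 2), ∫ ω, Z k ω ^ 2 ∂μ ≤ (r : ℝ) ^ 2 * C := by
      refine (Finset.sum_le_card_nsmul _ _ C fun k _ => hC k).trans (le_of_eq ?_)
      simp
    rw [div_le_iff₀ (by positivity)]
    refine h1.trans (le_of_eq ?_)
    field_simp
  have hVs : Summable fun r => ∫ ω, V r ω ∂μ := by
    refine Summable.of_nonneg_of_le (fun r => integral_nonneg fun ω => by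
      simp only [V, Pi.zero_apply]; positivity) (fun r => ?_) (hsq.mul_left (9 * C))
    simp only [V]
    rw [integral_div, integral_const_mul,
      integral_finsetSum _ fun k _ => (hZ k).integrable_sq]
    rcases Nat.eq_zero_or_pos r with rfl | hr
    · simp
    have hr1 : (1 : ℝ) ≤ r := by exact_mod_cast hr
    have h1 : ∑ k ∈ Finset.Ico (r ^ 2) ((r + 1) ^ 2), ∫ ω, Z k ω ^ 2 ∂μ ≤ (2 * r + 1) * C := by
      refine (Finset.sum_le_card_nsmul _ _ C fun k _ => hC k).trans (le_of_eq ?_)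
      have : (r + 1) ^ 2 - r ^ 2 = 2 * r + 1 := by
        rw [Nat.sub_eq_iff_eq_add (Nat.pow_le_pow_left (Nat.le_succ r) 2), Nat.succ_eq_add_one]; ring
      rw [Nat.card_Ico, this, nsmul_eq_mul]
      push_cast
      ring
    rw [div_le_iff₀ (by positivity)]
    have h2 : (2 * (r : ℝ) + 1) * ∑ k ∈ Finset.Ico (r ^ 2) ((r + 1) ^ 2), ∫ ω, Z k ω ^ 2 ∂μ
        ≤ (2 * r + 1) * ((2 * r + 1) * C) := mul_le_mul_of_nonneg_left h1 (by positivity)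
    refine h2.trans ?_
    have h3 : 9 * C * (1 / (r : ℝ) ^ 2) * (r : ℝ) ^ 4 = (3 * r) * ((3 * r) * C) := by
      field_simp; ring
    rw [h3]
    gcongr <;> linarith
  filter_upwards [ae_tendsto_zero_of_summable_integral hQi (fun r ω => by positivity) hQs,
    ae_tendsto_zero_of_summable_integral hVi (fun r ω => by simp only [V]; positivity) hVs]
    with ω hQ hV
  have hsqrt : Tendsto Nat.sqrt atTop atTop :=
    tendsto_atTop.2 fun k => by
      filter_upwards [eventually_ge_atTop (k * k)] with m hm
      exact Nat.le_sqrt.2 hm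
  have hlim : Tendsto (fun m : ℕ => 2 * Q (Nat.sqrt m) ω + 2 * V (Nat.sqrt m) ω) atTop (𝓝 0) := by
    have := ((hQ.comp hsqrt).const_mul 2).add ((hV.comp hsqrt).const_mul 2)
    simpa using this
  have hsq0 : Tendsto (fun m : ℕ => ((∑ k ∈ Finset.range m, Z k ω) / m) ^ 2) atTop (𝓝 0) := by
    refine tendsto_of_tendsto_of_tendsto_of_le_of_le' tendsto_const_nhds hlim
      (Eventually.of_forall fun m => sq_nonneg _) ?_
    filter_upwards [eventually_ge_atTop 1] with m hm
    set r := Nat.sqrt m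
    have hr : 1 ≤ r := Nat.le_sqrt.2 hm
    have hr0 : (0 : ℝ) < r := by exact_mod_cast hr
    have h1 : r ^ 2 ≤ m := by rw [sq]; exact Nat.sqrt_le m
    have h2 : m ≤ (r + 1) ^ 2 := by rw [sq]; exact (Nat.lt_succ_sqrt m).le
    have hsplit : ∑ k ∈ Finset.range m, Z k ω
        = ∑ k ∈ Finset.range (r ^ 2), Z k ω + ∑ k ∈ Finset.Ico (r ^ 2) m, Z k ω :=
      (Finset.sum_range_add_sum_Ico _ h1).symm
    have hcs : (∑ k ∈ Finset.Ico (r ^ 2) m, Z k ω) ^ 2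
        ≤ (2 * r + 1) * ∑ k ∈ Finset.Ico (r ^ 2) ((r + 1) ^ 2), Z k ω ^ 2 := by
      refine sq_sum_le_card_mul_sum_sq.trans ?_
      refine mul_le_mul ?_ (Finset.sum_le_sum_of_subset_of_nonneg
        (Finset.Ico_subset_Ico_right h2) fun k _ _ => sq_nonneg _)
        (Finset.sum_nonneg fun k _ => sq_nonneg _) (by positivity)
      rw [Nat.card_Ico]
      have : m - r ^ 2 ≤ 2 * r + 1 := by
        rw [Nat.sub_le_iff_le_add]
        refine h2.trans (le_of_eq (by ring))
      exact_mod_cast this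
    have hm2 : (r : ℝ) ^ 4 ≤ (m : ℝ) ^ 2 := by
      have : (r ^ 2) ^ 2 ≤ m ^ 2 := Nat.pow_le_pow_left h1 2
      have h3 : ((r ^ 2) ^ 2 : ℝ) ≤ (m : ℝ) ^ 2 := by exact_mod_cast this
      calc (r : ℝ) ^ 4 = (r ^ 2) ^ 2 := by ring
        _ ≤ _ := h3
    rw [div_pow]
    calc (∑ k ∈ Finset.range m, Z k ω) ^ 2 / (m : ℝ) ^ 2
        ≤ (∑ k ∈ Finset.range m, Z k ω) ^ 2 / (r : ℝ) ^ 4 :=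
          div_le_div_of_nonneg_left (sq_nonneg _) (by positivity) hm2
      _ ≤ (2 * (∑ k ∈ Finset.range (r ^ 2), Z k ω) ^ 2
          + 2 * ((2 * r + 1) * ∑ k ∈ Finset.Ico (r ^ 2) ((r + 1) ^ 2), Z k ω ^ 2))
            / (r : ℝ) ^ 4 := by
          gcongr
          rw [hsplit]
          nlinarith [sq_nonneg (∑ k ∈ Finset.range (r ^ 2), Z k ω
            - ∑ k ∈ Finset.Ico (r ^ 2) m, Z k ω)]
      _ = _ := by simp only [Q, V]; ring
  have := hsq0.sqrt
  simp only [Real.sqrt_sq_eq_abs, Real.sqrt_zero] at this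
  exact (tendsto_zero_iff_abs_tendsto_zero _).2 this

/-- The strong law of large numbers for independent random variables whose laws repeat
periodically. -/
theorem ae_tendsto_sum_of_periodic_law {Y : ℕ → Ω → ℝ} {K : ℕ} (hK : K ≠ 0)
    (hint : ∀ k, Integrable (Y k) μ) (hindep : ∀ i j, i ≠ j → IndepFun (Y i) (Y j) μ)
    (hident : ∀ k, IdentDistrib (Y (k + K)) (Y k) μ μ) :
    ∀ᵐ ω ∂μ, Tendsto (fun q : ℕ => (∑ k ∈ Finset.range (q * K), Y k ω) / (q : ℝ)) atTop
      (𝓝 (∑ r ∈ Finset.range K, ∫ ω, Y r ω ∂μ)) := by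
  -- Along each residue class modulo `K` the variables are identically distributed, so the classical
  -- strong law applies.
  have h : ∀ r, ∀ᵐ ω ∂μ, Tendsto
      (fun q : ℕ => (∑ i ∈ Finset.range q, Y (r + i * K) ω) / (q : ℝ)) atTop
      (𝓝 (∫ ω, Y r ω ∂μ)) := by
    intro r
    have := strong_law_ae_real (fun i => Y (r + i * K)) (hint _)
      (fun i j hij => hindep _ _ fun h => hij (Nat.eq_of_mul_eq_mul_right
        (Nat.pos_of_ne_zero hK) (Nat.add_left_cancel h))) (fun i => by
        induction i with
        | zero => exact IdentDistrib.refl (hint _).aemeasurable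
        | succ i ih =>
          have := hident (r + i * K)
          rw [add_assoc, ← Nat.succ_mul] at this
          exact this.trans ih)
    simpa using this
  filter_upwards [ae_all_iff.2 h] with ω hω
  simp only [sum_range_mul_eq_sum_residues]
  simp only [Finset.sum_div (Finset.range K)]
  exact tendsto_finsetSum _ fun r _ => hω r

variable {𝓖 : ℕ → MeasurableSpace Ω}

/-! ### Products of innovations and functions of the past -/

theorem pastSigma_le (hle : ∀ k, 𝓖 k ≤ mΩ) (k : ℕ) : pastSigma 𝓖 k ≤ mΩ :=
  iSup₂_le fun j _ => hle j

theorem indepFun_past (hle : ∀ k, 𝓖 k ≤ mΩ) (hind : iIndep 𝓖 μ) {k : ℕ} {U ψ : Ω → ℝ}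
    (hU : Measurable[pastSigma 𝓖 k] U) (hψ : Measurable[𝓖 k] ψ) : IndepFun U ψ μ := by
  have h := indep_iSup_of_disjoint hle hind (S := Set.Iio k) (T := {k})
    (Set.disjoint_singleton_right.2 (lt_irrefl k))
  rw [iSup_singleton] at h
  rw [IndepFun_iff_Indep]
  exact indep_of_indep_of_le_left (indep_of_indep_of_le_right h hψ.comap_le) hU.comap_le

theorem memLp_two_mul_past (hle : ∀ k, 𝓖 k ≤ mΩ) (hind : iIndep 𝓖 μ) {k : ℕ} {U ψ : Ω → ℝ}
    (hU : Measurable[pastSigma 𝓖 k] U) (hψ : Measurable[𝓖 k] ψ) (hU2 : MemLp U 2 μ)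
    (hψ2 : MemLp ψ 2 μ) : MemLp (fun ω => ψ ω * U ω) 2 μ ∧
      ∫ ω, (ψ ω * U ω) ^ 2 ∂μ = (∫ ω, ψ ω ^ 2 ∂μ) * ∫ ω, U ω ^ 2 ∂μ := by
  have hi : IndepFun (fun ω => ψ ω ^ 2) (fun ω => U ω ^ 2) μ :=
    (indepFun_past hle hind (hU.pow_const 2) (hψ.pow_const 2)).symm
  have e : ∀ ω, (ψ ω * U ω) ^ 2 = ψ ω ^ 2 * U ω ^ 2 := fun ω => mul_pow _ _ _
  constructor
  · refine (memLp_two_iff_integrable_sq (hψ2.1.mul hU2.1)).2 ?_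
    show Integrable (fun ω => (ψ ω * U ω) ^ 2) μ
    simp only [e]
    exact hi.integrable_mul hψ2.integrable_sq hU2.integrable_sq
  · simp only [e]
    exact hi.integral_mul_eq_mul_integral hψ2.integrable_sq.1 hU2.integrable_sq.1

/-- The products are orthogonal: for `i < j`, everything except the centred factor `ψ j` is
determined by the past of `j`. -/
theorem ae_tendsto_average_innovation_mul_past (hle : ∀ k, 𝓖 k ≤ mΩ) (hind : iIndep 𝓖 μ)
    {U ψ : ℕ → Ω → ℝ}
    (hU : ∀ k, Measurable[pastSigma 𝓖 k] (U k)) (hψ : ∀ k, Measurable[𝓖 k] (ψ k))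
    (hU2 : ∀ k, MemLp (U k) 2 μ) (hψ2 : ∀ k, MemLp (ψ k) 2 μ)
    (hψ0 : ∀ k, ∫ ω, ψ k ω ∂μ = 0) {C D : ℝ} (hC : ∀ k, ∫ ω, ψ k ω ^ 2 ∂μ ≤ C)
    (hD : ∀ k, ∫ ω, U k ω ^ 2 ∂μ ≤ D) :
    ∀ᵐ ω ∂μ, Tendsto (fun m : ℕ => (∑ k ∈ Finset.range m, ψ k ω * U k ω) / m) atTop (𝓝 0) := by
  refine ae_tendsto_average_zero_of_orthogonal (C := C * D)
    (fun k => (memLp_two_mul_past hle hind (hU k) (hψ k) (hU2 k) (hψ2 k)).1) ?_ fun k => ?_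
  · intro i j hij
    have hA : Measurable[pastSigma 𝓖 j] (fun ω => ψ i ω * U i ω * U j ω) :=
      (((hψ i).mono (le_pastSigma hij) le_rfl).mul
        ((hU i).mono (pastSigma_mono hij.le) le_rfl)).mul (hU j)
    have hi := indepFun_past hle hind hA (hψ j)
    -- The product rule for independent factors needs only measurability, so the triple product need
    -- not be shown integrable.
    have := hi.integral_mul_eq_mul_integral
      (hA.mono (pastSigma_le hle j) le_rfl).aestronglyMeasurable (hψ2 j).1
    rw [hψ0 j, mul_zero] at this
    rw [← this]
    refine integral_congr_ae (ae_of_all _ fun ω => ?_)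
    simp only [Pi.mul_apply]
    ring
  · rw [(memLp_two_mul_past hle hind (hU k) (hψ k) (hU2 k) (hψ2 k)).2]
    exact mul_le_mul (hC k) (hD k) (integral_nonneg fun ω => sq_nonneg _)
      ((integral_nonneg fun ω => sq_nonneg _).trans (hC k))

end LLN

/-! ### The age at the starts of the transmissions -/

theorem measurable_ageAtStart {Ω : Type*} {𝓖 : ℕ → MeasurableSpace Ω} {S B : ℕ → Ω → ℝ}
    (hSm : ∀ k, Measurable[𝓖 k] (S k))
    (hBm : ∀ k, Measurable[𝓖 k] (B k)) (k : ℕ) :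
    Measurable[pastSigma 𝓖 k] (fun ω => ageAtStart (S · ω) (B · ω) 0 k) := by
  induction k with
  | zero => exact measurable_const
  | succ k ih =>
    exact ((hSm k).mono (le_pastSigma (Nat.lt_succ_self k)) le_rfl).add
      (((hBm k).mono (le_pastSigma (Nat.lt_succ_self k)) le_rfl).mul
        (ih.mono (pastSigma_mono (Nat.le_succ k)) le_rfl))

section AgeProcess

variable {Ω : Type*} [mΩ : MeasurableSpace Ω] {μ : Measure Ω} [IsProbabilityMeasure μ]
  {𝓖 : ℕ → MeasurableSpace Ω} {S B : ℕ → Ω → ℝ}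

theorem ageAtStart_nonneg {S B : ℕ → ℝ} (hS : ∀ k, 0 ≤ S k) (hB : ∀ k, B k = 0 ∨ B k = 1) (k : ℕ) :
    0 ≤ ageAtStart S B 0 k := by
  induction k with
  | zero => exact le_rfl
  | succ k ih =>
    rw [ageAtStart]
    rcases hB k with h | h <;> rw [h] <;> linarith [hS k]

theorem memLp_ageAtStart (hle : ∀ k, 𝓖 k ≤ mΩ) (hSm : ∀ k, Measurable[𝓖 k] (S k))
    (hBm : ∀ k, Measurable[𝓖 k] (B k)) (hS2 : ∀ k, MemLp (S k) 2 μ)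
    (hB : ∀ k ω, B k ω = 0 ∨ B k ω = 1) (k : ℕ) :
    MemLp (fun ω => ageAtStart (S · ω) (B · ω) 0 k) 2 μ := by
  induction k with
  | zero => exact memLp_const 0
  | succ k ih =>
    refine (hS2 k).add (ih.mono ?_ (ae_of_all _ fun ω => ?_))
    · exact (((hBm k).mono (hle k) le_rfl).mul ((measurable_ageAtStart hSm hBm k).mono
        (pastSigma_le hle k) le_rfl)).aestronglyMeasurable
    · rcases hB k ω with h | h <;> simp [h]

theorem memLp_resetFactor (hle : ∀ k, 𝓖 k ≤ mΩ) (hBm : ∀ k, Measurable[𝓖 k] (B k))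
    (hB : ∀ k ω, B k ω = 0 ∨ B k ω = 1) (k : ℕ) : MemLp (B k) 2 μ :=
  MemLp.of_bound ((hBm k).mono (hle k) le_rfl).aestronglyMeasurable 1
    (ae_of_all _ fun ω => by rcases hB k ω with h | h <;> simp [h])

/-- `S k` and `B k` are each independent of `R k`, and `B k ^ 2 = B k`, so the first and then the
second moment of `R k` satisfy a recursion with the periodic factor `E[B k]`. In the second, the
cross term `2 * S k * B k * R k` is bounded by `2 * S k * R k`. -/
theorem exists_bound_ageAtStart (hle : ∀ k, 𝓖 k ≤ mΩ) (hind : iIndep 𝓖 μ)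
    (hSm : ∀ k, Measurable[𝓖 k] (S k)) (hBm : ∀ k, Measurable[𝓖 k] (B k))
    (hS2 : ∀ k, MemLp (S k) 2 μ) (hS0 : ∀ k, ∀ᵐ ω ∂μ, 0 ≤ S k ω)
    (hB : ∀ k ω, B k ω = 0 ∨ B k ω = 1) {K : ℕ} (hK : K ≠ 0)
    (hσ : Function.Periodic (fun k => ∫ ω, S k ω ∂μ) K)
    (hq : Function.Periodic (fun k => ∫ ω, S k ω ^ 2 ∂μ) K)
    (hb : Function.Periodic (fun k => ∫ ω, B k ω ∂μ) K)
    (hρ : ∏ k ∈ Finset.range K, ∫ ω, B k ω ∂μ < 1) :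
    ∃ C, ∀ k, ∫ ω, ageAtStart (S · ω) (B · ω) 0 k ^ 2 ∂μ ≤ C := by
  set R : ℕ → Ω → ℝ := fun k ω => ageAtStart (S · ω) (B · ω) 0 k with hR
  have hRm := measurable_ageAtStart hSm hBm
  have hR2 : ∀ k, MemLp (R k) 2 μ := memLp_ageAtStart hle hSm hBm hS2 hB
  have hB2 : ∀ k, MemLp (B k) 2 μ := memLp_resetFactor hle hBm hB
  have hSi : ∀ k, Integrable (S k) μ := fun k => (hS2 k).integrable one_le_two
  have hRi : ∀ k, Integrable (R k) μ := fun k => (hR2 k).integrable one_le_two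
  have hS0' : ∀ᵐ ω ∂μ, ∀ k, 0 ≤ S k ω := ae_all_iff.2 hS0
  have hR0 : ∀ k, ∀ᵐ ω ∂μ, 0 ≤ R k ω := fun k => by
    filter_upwards [hS0'] with ω hω
    exact ageAtStart_nonneg hω (fun j => hB j ω) k
  have hb0 : ∀ k, 0 ≤ ∫ ω, B k ω ∂μ := fun k => integral_nonneg fun ω => by
    rcases hB k ω with h | h <;> simp [h]
  have hσ0 : ∀ k, 0 ≤ ∫ ω, S k ω ∂μ := fun k => integral_nonneg_of_ae (hS0 k)
  obtain ⟨Cσ, hCσ⟩ := hσ.exists_abs_le hK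
  obtain ⟨Cq, hCq⟩ := hq.exists_abs_le hK
  have hCσ0 : 0 ≤ Cσ := (abs_nonneg _).trans (hCσ 0)
  have hCq0 : 0 ≤ Cq := (abs_nonneg _).trans (hCq 0)
  have hindSR : ∀ k, ∫ ω, S k ω * R k ω ∂μ = (∫ ω, S k ω ∂μ) * ∫ ω, R k ω ∂μ := fun k =>
    (indepFun_past hle hind (hRm k) (hSm k)).symm.integral_mul_eq_mul_integral
      (hSi k).1 (hRi k).1
  have hindBR : ∀ k, ∫ ω, B k ω * R k ω ∂μ = (∫ ω, B k ω ∂μ) * ∫ ω, R k ω ∂μ := fun k =>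
    (indepFun_past hle hind (hRm k) (hBm k)).symm.integral_mul_eq_mul_integral
      (hB2 k).1 (hRi k).1
  have hindBR2 : ∀ k, ∫ ω, B k ω * R k ω ^ 2 ∂μ = (∫ ω, B k ω ∂μ) * ∫ ω, R k ω ^ 2 ∂μ := fun k =>
    (indepFun_past hle hind ((hRm k).pow_const 2) (hBm k)).symm.integral_mul_eq_mul_integral
      (hB2 k).1 (hR2 k).integrable_sq.1
  have hBRi : ∀ k, Integrable (fun ω => B k ω * R k ω) μ := fun k =>
    (hB2 k).integrable_mul (hR2 k)
  have hSRi : ∀ k, Integrable (fun ω => S k ω * R k ω) μ := fun k =>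
    (hS2 k).integrable_mul (hR2 k)
  have hBR2i : ∀ k, Integrable (fun ω => B k ω * R k ω ^ 2) μ := fun k =>
    (indepFun_past hle hind ((hRm k).pow_const 2) (hBm k)).symm.integrable_mul
      ((hB2 k).integrable one_le_two) (hR2 k).integrable_sq
  obtain ⟨C₁, hC₁⟩ := bounded_of_periodic_contraction (x := fun k => ∫ ω, R k ω ∂μ) hK hb hρ hb0
    (fun k => integral_nonneg_of_ae (hR0 k)) hCσ0 fun k => by
      have e : ∀ ω, R (k + 1) ω = S k ω + B k ω * R k ω := fun ω => rfl
      simp only [e]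
      rw [integral_add (hSi k) (hBRi k), hindBR]
      linarith [(le_abs_self _).trans (hCσ k)]
  have hC₁0 : 0 ≤ C₁ := (integral_nonneg_of_ae (hR0 0)).trans (hC₁ 0)
  refine bounded_of_periodic_contraction (x := fun k => ∫ ω, R k ω ^ 2 ∂μ) (h := Cq + 2 * (Cσ * C₁))
    hK hb hρ hb0 (fun k => integral_nonneg fun ω => sq_nonneg _) (by positivity) fun k => ?_
  have hle1 : ∫ ω, R (k + 1) ω ^ 2 ∂μ
      ≤ ∫ ω, (S k ω ^ 2 + 2 * (S k ω * R k ω)) + B k ω * R k ω ^ 2 ∂μ := by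
    refine integral_mono_ae (hR2 _).integrable_sq
      (((hS2 k).integrable_sq.add ((hSRi k).const_mul 2)).add (hBR2i k)) ?_
    filter_upwards [hR0 k, hS0 k] with ω h1 h2
    have e : R (k + 1) ω = S k ω + B k ω * R k ω := rfl
    rw [e]
    rcases hB k ω with h | h <;> rw [h]
    · nlinarith [mul_nonneg h2 h1]
    · nlinarith
  refine hle1.trans ?_
  rw [integral_add (f := fun ω => S k ω ^ 2 + 2 * (S k ω * R k ω))
    ((hS2 k).integrable_sq.add ((hSRi k).const_mul 2)) (hBR2i k),
    integral_add (hS2 k).integrable_sq ((hSRi k).const_mul 2), integral_const_mul, hindSR, hindBR2]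
  have h1 : ∫ ω, S k ω ^ 2 ∂μ ≤ Cq := (le_abs_self _).trans (hCq k)
  have h2 : (∫ ω, S k ω ∂μ) * ∫ ω, R k ω ∂μ ≤ Cσ * C₁ :=
    mul_le_mul ((le_abs_self _).trans (hCσ k)) (hC₁ k) (integral_nonneg_of_ae (hR0 k)) hCσ0
  linarith

/-- Telescoping of `c k * R k`: its increment is `c (k + 1) * S k + c (k + 1) * (B k - b k) * R k -
σ k * R k`, which expresses `σ k * R k`, and hence `S k * R k`, through centred terms. -/
theorem sum_mul_ageAtStart (S B σ b c : ℕ → ℝ) (hc : ∀ k, c k = σ k + b k * c (k + 1)) (m : ℕ) :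
    ∑ k ∈ Finset.range m, S k * ageAtStart S B 0 k
      = ∑ k ∈ Finset.range m, ((S k - σ k) + c (k + 1) * (B k - b k)) * ageAtStart S B 0 k
        + ∑ k ∈ Finset.range m, c (k + 1) * (S k - σ k) + ∑ k ∈ Finset.range m, c (k + 1) * σ k
        - c m * ageAtStart S B 0 m := by
  induction m with
  | zero => simp [ageAtStart]
  | succ m ih =>
    simp only [Finset.sum_range_succ, ih, ageAtStart]
    rw [hc m]
    ring

theorem tendsto_mul_subseq {f : ℕ → ℝ} {K : ℕ} (hK : K ≠ 0)
    (hf : Tendsto (fun m : ℕ => f m / m) atTop (𝓝 0)) :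
    Tendsto (fun q : ℕ => f (q * K) / (q : ℝ)) atTop (𝓝 0) := by
  have h1 : Tendsto (fun q : ℕ => q * K) atTop atTop :=
    tendsto_id.atTop_mul_const' (Nat.pos_of_ne_zero hK)
  have h2 := (hf.comp h1).mul_const (K : ℝ)
  rw [zero_mul] at h2
  refine h2.congr fun q => ?_
  have : (K : ℝ) ≠ 0 := by exact_mod_cast hK
  simp only [Function.comp]
  push_cast
  rw [div_mul_eq_mul_div, mul_div_mul_right _ _ this]

/-- The law of large numbers for the age of a source: `c` solves the Poisson equation
`c k = E[S k] + E[B k] * c (k + 1)`. -/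
theorem ae_tendsto_sum_mul_ageAtStart (hle : ∀ k, 𝓖 k ≤ mΩ) (hind : iIndep 𝓖 μ)
    (hSm : ∀ k, Measurable[𝓖 k] (S k)) (hBm : ∀ k, Measurable[𝓖 k] (B k))
    (hS2 : ∀ k, MemLp (S k) 2 μ) (hS0 : ∀ k, ∀ᵐ ω ∂μ, 0 ≤ S k ω)
    (hB : ∀ k ω, B k ω = 0 ∨ B k ω = 1) {K : ℕ} (hK : K ≠ 0)
    (hσ : Function.Periodic (fun k => ∫ ω, S k ω ∂μ) K)
    (hq : Function.Periodic (fun k => ∫ ω, S k ω ^ 2 ∂μ) K)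
    (hb : Function.Periodic (fun k => ∫ ω, B k ω ∂μ) K)
    (hρ : ∏ k ∈ Finset.range K, ∫ ω, B k ω ∂μ < 1) {c : ℕ → ℝ} (hcK : Function.Periodic c K)
    (hc : ∀ k, c k = ∫ ω, S k ω ∂μ + (∫ ω, B k ω ∂μ) * c (k + 1)) :
    ∀ᵐ ω ∂μ, Tendsto (fun q : ℕ => startTime S (q * K) ω / q) atTop
        (𝓝 (∑ k ∈ Finset.range K, ∫ ω, S k ω ∂μ)) ∧
      Tendsto (fun q : ℕ => ageAtStart (S · ω) (B · ω) 0 (q * K) / q) atTop (𝓝 0) ∧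
      Tendsto (fun q : ℕ => (∑ k ∈ Finset.range (q * K),
        S k ω * ageAtStart (S · ω) (B · ω) 0 k) / (q : ℝ)) atTop
        (𝓝 (∑ k ∈ Finset.range K, c (k + 1) * ∫ ω, S k ω ∂μ)) := by
  set σ : ℕ → ℝ := fun k => ∫ ω, S k ω ∂μ with hσdef
  set b : ℕ → ℝ := fun k => ∫ ω, B k ω ∂μ with hbdef
  have hRm := measurable_ageAtStart hSm hBm
  have hR2 := memLp_ageAtStart (μ := μ) hle hSm hBm hS2 hB
  have hB2 : ∀ k, MemLp (B k) 2 μ := memLp_resetFactor hle hBm hB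
  have hSi : ∀ k, Integrable (S k) μ := fun k => (hS2 k).integrable one_le_two
  have hBi : ∀ k, Integrable (B k) μ := fun k => (hB2 k).integrable one_le_two
  obtain ⟨C, hC⟩ := exists_bound_ageAtStart hle hind hSm hBm hS2 hS0 hB hK hσ hq hb hρ
  obtain ⟨M, hM⟩ := hcK.exists_abs_le hK
  have hM0 : 0 ≤ M := (abs_nonneg _).trans (hM 0)
  obtain ⟨Cq, hCq⟩ := hq.exists_abs_le hK
  have hvar : ∀ k, ∫ ω, (S k ω - σ k) ^ 2 ∂μ ≤ Cq := fun k => by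
    have h1 := variance_eq_integral (hS2 k).aemeasurable
    have h2 := variance_le_expectation_sq (hS2 k).1
    rw [h1] at h2
    exact h2.trans ((le_abs_self _).trans (hCq k))
  have hSc2 : ∀ k, MemLp (fun ω => S k ω - σ k) 2 μ := fun k => (hS2 k).sub (memLp_const _)
  have hBc2 : ∀ k, MemLp (fun ω => B k ω - b k) 2 μ := fun k => (hB2 k).sub (memLp_const _)
  have hSc0 : ∀ k, ∫ ω, (S k ω - σ k) ∂μ = 0 := fun k => by
    rw [integral_sub (hSi k) (integrable_const _)]; simp [hσdef]
  have hBc0 : ∀ k, ∫ ω, (B k ω - b k) ∂μ = 0 := fun k => by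
    rw [integral_sub (hBi k) (integrable_const _)]; simp [hbdef]
  have hBcle : ∀ k, ∀ ω, (B k ω - b k) ^ 2 ≤ 1 := fun k ω => by
    have h0 : 0 ≤ b k := integral_nonneg fun ω => by rcases hB k ω with h | h <;> simp [h]
    have h1 : b k ≤ 1 := by
      have := integral_mono (hBi k) (integrable_const (1 : ℝ)) fun ω => by
        rcases hB k ω with h | h <;> simp [h]
      simpa using this
    rcases hB k ω with h | h <;> rw [h] <;> nlinarith
  have hmart := ae_tendsto_average_innovation_mul_past (μ := μ) hle hind
    (ψ := fun k ω => (S k ω - σ k) + c (k + 1) * (B k ω - b k))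
    (U := fun k ω => ageAtStart (S · ω) (B · ω) 0 k) (C := 2 * Cq + 2 * M ^ 2) (D := C) hRm
    (fun k => ((hSm k).sub_const _).add (((hBm k).sub_const _).const_mul _)) hR2
    (fun k => (hSc2 k).add ((hBc2 k).const_mul _))
    (fun k => by
      rw [integral_add ((hSc2 k).integrable one_le_two)
        (((hBc2 k).integrable one_le_two).const_mul _), integral_const_mul, hSc0, hBc0]
      simp) (fun k => by
      have h1 : ∫ ω, ((S k ω - σ k) + c (k + 1) * (B k ω - b k)) ^ 2 ∂μ
          ≤ ∫ ω, (2 * (S k ω - σ k) ^ 2 + 2 * M ^ 2) ∂μ := by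
        refine integral_mono ((hSc2 k).add ((hBc2 k).const_mul _)).integrable_sq
          (((hSc2 k).integrable_sq.const_mul 2).add (integrable_const _)) fun ω => ?_
        have h2 : (c (k + 1) * (B k ω - b k)) ^ 2 ≤ M ^ 2 := by
          rw [mul_pow]
          have h3 : c (k + 1) ^ 2 ≤ M ^ 2 := sq_le_sq' (by linarith [(abs_le.1 (hM (k + 1))).1])
            (abs_le.1 (hM (k + 1))).2
          have := mul_le_mul h3 (hBcle k ω) (sq_nonneg _) (sq_nonneg M)
          linarith
        simp only
        nlinarith [sq_nonneg ((S k ω - σ k) - c (k + 1) * (B k ω - b k))]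
      rw [integral_add ((hSc2 k).integrable_sq.const_mul 2) (integrable_const _),
        integral_const_mul] at h1
      have := hvar k
      simp only [integral_const, probReal_univ, one_smul] at h1
      linarith) hC
  -- Used with `d = 1` for the elapsed time and with `d k = c (k + 1)` for the telescoped sum; `M +
  -- 1` bounds both weights.
  have hServ := fun d : ℕ → ℝ => fun (hd : ∀ k, |d k| ≤ M + 1) =>
    ae_tendsto_average_innovation_mul_past (μ := μ) hle hind
    (ψ := fun k ω => d k * (S k ω - σ k)) (U := fun _ _ => 1) (C := (M + 1) ^ 2 * Cq) (D := 1)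
    (fun k => measurable_const) (fun k => ((hSm k).sub_const _).const_mul _)
    (fun k => memLp_const _) (fun k => (hSc2 k).const_mul _)
    (fun k => by rw [integral_const_mul, hSc0, mul_zero]) (fun k => by
      simp only [mul_pow]
      rw [integral_const_mul]
      exact mul_le_mul (sq_le_sq' (by linarith [(abs_le.1 (hd k)).1]) (abs_le.1 (hd k)).2) (hvar k)
        (integral_nonneg fun ω => sq_nonneg _) (sq_nonneg _)) (fun k => by simp)
  filter_upwards [hmart, hServ (fun _ => 1) (fun k => by simpa using hM0),
    hServ (fun k => c (k + 1)) (fun k => (hM _).trans (by linarith)),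
    ae_tendsto_div_zero_of_bounded_sq hR2 hC] with ω h1 h2 h3 h4
  have hper : ∀ f : ℕ → ℝ, Function.Periodic f K →
      Tendsto (fun q : ℕ => (∑ k ∈ Finset.range (q * K), f k) / (q : ℝ)) atTop
        (𝓝 (∑ k ∈ Finset.range K, f k)) := fun f hf => by
    refine tendsto_const_nhds.congr' ?_
    filter_upwards [eventually_gt_atTop 0] with q hq
    have : (q : ℝ) ≠ 0 := by positivity
    rw [hf.sum_range_mul]
    field_simp
  refine ⟨?_, tendsto_mul_subseq hK h4, ?_⟩
  · have := (tendsto_mul_subseq hK h2).add (hper σ hσ)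
    rw [zero_add] at this
    refine this.congr fun q => ?_
    rw [← add_div, ← Finset.sum_add_distrib]
    simp [startTime]
  · have h5 : Tendsto (fun m : ℕ => (c m * ageAtStart (S · ω) (B · ω) 0 m) / m) atTop (𝓝 0) := by
      simp only [mul_div_assoc]
      refine bdd_le_mul_tendsto_zero' M (Eventually.of_forall fun m => hM m) h4
    have hcs : Function.Periodic (fun k => c (k + 1) * σ k) K := fun k => by
      have e1 : c (k + K + 1) = c (k + 1) := by rw [add_right_comm]; exact hcK _
      have e2 : σ (k + K) = σ k := hσ k
      simp only [e1, e2]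
    have := (((tendsto_mul_subseq hK h1).add (tendsto_mul_subseq hK h3)).add (hper _ hcs)).sub
      (tendsto_mul_subseq hK h5)
    simp only [add_zero, zero_add, sub_zero, mul_one] at this
    refine this.congr fun q => ?_
    rw [← add_div, ← add_div, ← sub_div,
      ← sum_mul_ageAtStart (S · ω) (B · ω) σ b c hc]

end AgeProcess

/-! ### The transmission model -/

section Model

variable {K N : ℕ} [NeZero K] {P : Fin K → Fin N}

theorem sched_periodic : Function.Periodic (sched P) K := fun k => by
  simp only [sched]
  congr 1
  apply Fin.ext
  simp [Fin.ofNat]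

theorem sched_val (k : Fin K) : sched P k = P k := by
  simp [sched]

theorem tendsto_sum_div_of_eventually_zero {u : ℕ → ℝ} {m K : ℕ} (hK : K ≠ 0)
    (hu : ∀ k ≥ m, u k = 0) :
    Tendsto (fun q : ℕ => (∑ k ∈ Finset.range (q * K), u k) / (q : ℝ)) atTop (𝓝 0) := by
  have h : Tendsto (fun q : ℕ => (∑ k ∈ Finset.range m, u k) / (q : ℝ)) atTop (𝓝 0) :=
    tendsto_const_div_atTop_nhds_zero_nat _
  refine h.congr' ?_
  filter_upwards [eventually_ge_atTop m] with q hq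
  rw [Finset.eventually_constant_sum hu (hq.trans (Nat.le_mul_of_pos_right q
    (Nat.pos_of_ne_zero hK)))]

theorem ageAtStart_eq_startTime {Ω : Type*} {S : ℕ → Ω → ℝ} {B : ℕ → ℝ} {ω : Ω}
    (hB : ∀ k, B k = 1) (k : ℕ) : ageAtStart (S · ω) B 0 k = startTime S k ω := by
  induction k with
  | zero => simp [ageAtStart, startTime]
  | succ k ih => rw [ageAtStart, ih, hB, one_mul, startTime_succ, add_comm]

theorem resetFactor_eq_zero_or_one {Ω : Type*} {X : ℕ → Ω → Bool} (n : Fin N) (k : ℕ) (ω : Ω) :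
    resetFactor P X n k ω = 0 ∨ resetFactor P X n k ω = 1 := by
  unfold resetFactor
  split_ifs <;> simp

variable {Ω : Type*} [MeasurableSpace Ω] {μ : Measure Ω}
  {F : Fin N → Measure ℝ} {p : Fin N → ℝ} {S : ℕ → Ω → ℝ} {X : ℕ → Ω → Bool}

namespace IsCyclicTransmission

theorem memLp_service (hmodel : IsCyclicTransmission P μ F p S X) (k : ℕ) : MemLp (S k) 2 μ := by
  have h := hmodel.service_memLp (sched P k)
  rw [← (hmodel.service_law k).map_eq] at h
  exact (memLp_map_measure_iff h.1 (hmodel.service_law k).aemeasurable).1 h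

theorem integral_service (hmodel : IsCyclicTransmission P μ F p S X) (k : ℕ) : ∫ ω, S k ω ∂μ = ∫ x, x ∂F (sched P k) :=
  (hmodel.service_law k).integral_comp (f := fun x : ℝ => x) measurable_id.aestronglyMeasurable

theorem integral_service_sq (hmodel : IsCyclicTransmission P μ F p S X) (k : ℕ) : ∫ ω, S k ω ^ 2 ∂μ = ∫ x, x ^ 2 ∂F (sched P k) :=
  (hmodel.service_law k).integral_comp (f := fun x : ℝ => x ^ 2)
    (measurable_id.pow_const 2).aestronglyMeasurable

theorem ae_service_nonneg (hmodel : IsCyclicTransmission P μ F p S X) (k : ℕ) : ∀ᵐ ω ∂μ, 0 ≤ S k ω := by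
  have h := hmodel.service_nonneg (sched P k)
  rw [← (hmodel.service_law k).map_eq] at h
  exact ae_of_ae_map (hmodel.service_law k).aemeasurable h

theorem indepFun_service (hmodel : IsCyclicTransmission P μ F p S X) {i j : ℕ} (hij : i ≠ j) : IndepFun (S i) (S j) μ :=
  (hmodel.indep_packets.indepFun hij).comp measurable_fst measurable_fst

theorem integral_resetFactor [IsProbabilityMeasure μ]
    (hmodel : IsCyclicTransmission P μ F p S X) (n : Fin N) (k : ℕ) :
    ∫ ω, resetFactor P X n k ω ∂μ = if sched P k = n then p n else 1 := by
  by_cases h : sched P k = n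
  · have e : ∀ ω, resetFactor P X n k ω = Set.indicator {ω | X k ω = false} 1 ω := fun ω => by
      rcases hX : X k ω <;> simp [resetFactor, h, hX]
    have hm : MeasurableSet {ω | X k ω = false} :=
      hmodel.measurable_received k (measurableSet_singleton false)
    simp only [e]
    rw [integral_indicator_one hm, hmodel.drop_prob k, if_pos h, h]
  · simp [resetFactor, h]

/-- The mean age of source `n` in terms of the expected time `c k` between the start of
transmission `k` and the end of the next reception from source `n`. -/
theorem hasMeanAoI [IsProbabilityMeasure μ]
    (hmodel : IsCyclicTransmission P μ F p S X) {δ : Fin N → Ω → ℝ} {n : Fin N} (hδ : ∀ ω, 0 ≤ δ n ω)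
    (hn : ∃ k, P k = n) (hp : ∀ m, 0 ≤ p m ∧ p m < 1)
    (hpos : 0 < ∑ k ∈ Finset.range K, ∫ x, x ∂F (sched P k)) :
    ∃ c : ℕ → ℝ, Function.Periodic c K ∧
      (∀ k, c k = ∫ x, x ∂F (sched P k) + (if sched P k = n then p n else 1) * c (k + 1)) ∧
      HasMeanAoI P μ S X δ n
        ((∑ k ∈ Finset.range K, c (k + 1) * ∫ x, x ∂F (sched P k)
          + ∑ k ∈ Finset.range K, (∫ x, x ^ 2 ∂F (sched P k)) / 2)
          / ∑ k ∈ Finset.range K, ∫ x, x ∂F (sched P k)) := by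
  have hK : K ≠ 0 := NeZero.ne K
  let 𝓖 : ℕ → MeasurableSpace Ω := fun k =>
    MeasurableSpace.comap (fun ω => (S k ω, X k ω)) inferInstance
  have hpair : ∀ k, Measurable[𝓖 k] (fun ω => (S k ω, X k ω)) := fun k => comap_measurable _
  have hle : ∀ k, 𝓖 k ≤ ‹MeasurableSpace Ω› := fun k =>
    ((hmodel.measurable_service k).prodMk (hmodel.measurable_received k)).comap_le
  have hind : iIndep 𝓖 μ := hmodel.indep_packets
  have hSm : ∀ k, Measurable[𝓖 k] (S k) := fun k => measurable_fst.comp (hpair k)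
  have hBm : ∀ k, Measurable[𝓖 k] (resetFactor P X n k) := fun k => by
    have h : Measurable fun x : Bool => if sched P k = n ∧ x = true then (0 : ℝ) else 1 :=
      measurable_of_countable _
    exact h.comp (measurable_snd.comp (hpair k))
  have hper : ∀ f : Fin N → ℝ, Function.Periodic (fun k => f (sched P k)) K := fun f k => by
    simp only [sched_periodic k]
  have hb := hper fun m => if m = n then p n else 1
  have hb0 : ∀ k, 0 ≤ (if sched P k = n then p n else (1 : ℝ)) := fun k => by
    split_ifs
    · exact (hp n).1
    · exact zero_le_one
  have hb1 : ∀ k, (if sched P k = n then p n else (1 : ℝ)) ≤ 1 := fun k => by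
    split_ifs
    · exact (hp n).2.le
    · exact le_rfl
  -- One slot of source `n` contributes the factor `p n < 1`; all the others are at most `1`.
  have hρ : ∏ k ∈ Finset.range K, (if sched P k = n then p n else (1 : ℝ)) < 1 := by
    obtain ⟨k₀, hk₀⟩ := hn
    rw [← Finset.mul_prod_erase _ _ (Finset.mem_range.2 k₀.isLt), sched_val, if_pos hk₀]
    refine lt_of_le_of_lt ?_ (hp n).2
    exact mul_le_of_le_one_right (hp n).1
      (Finset.prod_le_one (fun k _ => hb0 k) fun k _ => hb1 k)
  have hσ0 : ∀ k, 0 ≤ ∫ x, x ∂F (sched P k) := fun k =>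
    integral_nonneg_of_ae (hmodel.service_nonneg _)
  obtain ⟨c, hcK, -, hc⟩ := exists_periodic_backward_recursion hb
    (hper fun m => ∫ x, x ∂F m) hρ hb0 hσ0
  refine ⟨c, hcK, hc, ?_⟩
  have hmain := ae_tendsto_sum_mul_ageAtStart (μ := μ) hle hind hSm hBm hmodel.memLp_service
    hmodel.ae_service_nonneg (fun k ω => resetFactor_eq_zero_or_one n k ω) hK
    (by simpa only [hmodel.integral_service] using hper fun m => ∫ x, x ∂F m)
    (by simpa only [hmodel.integral_service_sq] using hper fun m => ∫ x, x ^ 2 ∂F m)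
    (by simpa only [hmodel.integral_resetFactor] using hb)
    (by simpa only [hmodel.integral_resetFactor] using hρ) hcK
    (by simpa only [hmodel.integral_service, hmodel.integral_resetFactor] using hc)
  -- The squares are only known to be integrable, so orthogonality in `L²` is not available for
  -- them.
  have hsq := ae_tendsto_sum_of_periodic_law (μ := μ) (Y := fun k ω => S k ω ^ 2 / 2) hK
    (fun k => (hmodel.memLp_service k).integrable_sq.div_const 2)
    (fun i j hij => (hmodel.indepFun_service hij).comp
      ((measurable_id.pow_const 2).div_const 2) ((measurable_id.pow_const 2).div_const 2))
    (fun k => by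
      have h := (hmodel.service_law (k + K))
      rw [sched_periodic k] at h
      exact (h.identDistrib (hmodel.service_law k)).comp
        (u := fun x : ℝ => x ^ 2 / 2) ((measurable_id.pow_const 2).div_const 2))
  filter_upwards [hmain, hsq, ae_all_iff.2 hmodel.ae_service_nonneg] with ω h1 h2 hS
  obtain ⟨hT, hR, hSR⟩ := h1
  simp only [hmodel.integral_service] at hT hSR
  simp only [integral_div, hmodel.integral_service_sq] at h2
  -- Without any reception the age started from `0` would equal the elapsed time, which grows at a
  -- positive rate, against `hR`.
  obtain ⟨m, hm⟩ : ∃ m, resetFactor P X n m ω = 0 := by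
    by_contra hcon
    push Not at hcon
    have hone : ∀ k, resetFactor P X n k ω = 1 := fun k =>
      (resetFactor_eq_zero_or_one n k ω).resolve_left (hcon k)
    simp only [ageAtStart_eq_startTime hone] at hR
    exact hpos.ne' (tendsto_nhds_unique hT hR)
  refine hasTimeAverage_age hS (hδ ω) hpos hT ?_
  have hinit := tendsto_sum_div_of_eventually_zero hK (m := m + 1)
    (u := fun k => S k ω * (δ n ω * ∏ i ∈ Finset.range k, resetFactor P X n i ω)) fun k hk => by
      rw [Finset.prod_eq_zero (Finset.mem_range.2 hk) hm, mul_zero, mul_zero]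
  have := (hSR.add hinit).add h2
  rw [add_zero] at this
  refine this.congr fun q => ?_
  rw [← add_div, ← add_div, ← Finset.sum_add_distrib, ← Finset.sum_add_distrib]
  congr 1
  refine Finset.sum_congr rfl fun k _ => ?_
  rw [ageAtStart_eq_add _ _ (δ n ω)]
  ring

end IsCyclicTransmission

end Model

/-! ### Sums of squares of cyclic windows -/

theorem Function.Periodic.sum_shift {f : ℕ → ℝ} {m : ℕ} (hf : Function.Periodic f m) (i : ℕ) :
    ∑ j ∈ Finset.range m, f (j + i) = ∑ j ∈ Finset.range m, f j := by
  rw [← hf.sum_range_add i]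
  exact Finset.sum_congr rfl fun j _ => by rw [add_comm]

/-- The sum of the squares of the sums of `i` consecutive terms of an `m`-periodic sequence. -/
noncomputable def windowSquareSum (m : ℕ) (y : ℕ → ℝ) (i : ℕ) : ℝ :=
  ∑ j ∈ Finset.range m, (∑ k ∈ Finset.range i, y (j + k)) ^ 2

/-- The cyclic autocorrelation of an `m`-periodic sequence. -/
noncomputable def autocorrelation (m : ℕ) (y : ℕ → ℝ) (i : ℕ) : ℝ :=
  ∑ j ∈ Finset.range m, y j * y (j + i)

section Window

variable {m : ℕ} {y : ℕ → ℝ}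

theorem window_periodic (hy : Function.Periodic y m) (i : ℕ) :
    Function.Periodic (fun j => ∑ k ∈ Finset.range i, y (j + k)) m := fun j =>
  Finset.sum_congr rfl fun k _ => by rw [add_right_comm]; exact hy _

theorem window_succ' (j i : ℕ) : ∑ k ∈ Finset.range (i + 1), y (j + k)
    = y j + ∑ k ∈ Finset.range i, y (j + 1 + k) := by
  rw [Finset.sum_range_succ', add_zero, add_comm]
  congr 1
  exact Finset.sum_congr rfl fun k _ => by rw [add_comm k 1, add_assoc]

theorem windowSquareSum_shift (hy : Function.Periodic y m) (i : ℕ) :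
    windowSquareSum m y i = ∑ j ∈ Finset.range m, (∑ k ∈ Finset.range i, y (j + 1 + k)) ^ 2 :=
  (Function.Periodic.sum_shift (f := fun j => (∑ k ∈ Finset.range i, y (j + k)) ^ 2)
    ((window_periodic hy i).comp fun x => x ^ 2) 1).symm

/-- With `T` the sum of the `i` terms strictly between `u = y j` and `v = y (j + i + 1)`, this is
`(u + T + v)² - (u + T)² - (T + v)² + T² = 2uv` summed over `j`. One of the two middle windows and
the short one are shifted cyclically by one to nest in this way. -/
theorem windowSquareSum_second_difference (hy : Function.Periodic y m) (i : ℕ) :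
    windowSquareSum m y (i + 2) - 2 * windowSquareSum m y (i + 1) + windowSquareSum m y i
      = 2 * autocorrelation m y (i + 1) := by
  have e : windowSquareSum m y (i + 2) - windowSquareSum m y (i + 1)
      - windowSquareSum m y (i + 1) + windowSquareSum m y i
      = 2 * autocorrelation m y (i + 1) := by
    nth_rewrite 2 [windowSquareSum_shift hy]
    rw [windowSquareSum_shift hy i]
    simp only [windowSquareSum, autocorrelation]
    rw [← Finset.sum_sub_distrib, ← Finset.sum_sub_distrib, ← Finset.sum_add_distrib,
      Finset.mul_sum]
    refine Finset.sum_congr rfl fun j _ => ?_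
    rw [window_succ' j (i + 1), window_succ' j i, Finset.sum_range_succ]
    have : j + 1 + i = j + (i + 1) := by ring
    rw [this]
    ring
  linarith

theorem windowSquareSum_zero : windowSquareSum m y 0 = 0 := by simp [windowSquareSum]

theorem windowSquareSum_period (hy : Function.Periodic y m)
    (hy0 : ∑ j ∈ Finset.range m, y j = 0) : windowSquareSum m y m = 0 :=
  Finset.sum_eq_zero fun j _ => by rw [hy.sum_range_add, hy0]; simp

theorem windowSquareSum_one : windowSquareSum m y 1 = ∑ j ∈ Finset.range m, y j ^ 2 := by
  simp [windowSquareSum]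

theorem windowSquareSum_period_add_one (hy : Function.Periodic y m)
    (hy0 : ∑ j ∈ Finset.range m, y j = 0) :
    windowSquareSum m y (m + 1) = windowSquareSum m y 1 := by
  rw [windowSquareSum_one]
  refine Finset.sum_congr rfl fun j _ => ?_
  rw [window_succ', hy.sum_range_add, hy0, add_zero]

/-- Summation by parts: an interior `d (i + 1)` gets the coefficient `p ^ i - 2 * p ^ (i + 1) + p ^
(i + 2) = (1 - p) ^ 2 * p ^ i`. -/
theorem geom_sum_second_difference (d : ℕ → ℝ) (p : ℝ) (n : ℕ) :
    p * ∑ i ∈ Finset.range n, p ^ i * (d (i + 2) - 2 * d (i + 1) + d i)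
      = (1 - p) ^ 2 * ∑ i ∈ Finset.range n, d (i + 1) * p ^ i - d 1 + p ^ n * d (n + 1)
        + p * d 0 - p ^ (n + 1) * d n := by
  induction n with
  | zero => simp
  | succ n ih =>
    rw [Finset.sum_range_succ, Finset.sum_range_succ, mul_add, ih]
    ring

/-- A window of full length sums to zero, so the boundary terms reduce to multiples of
`windowSquareSum m y 1`. This is why the sequence has to be centred. -/
theorem geom_sum_autocorrelation (hy : Function.Periodic y m)
    (hy0 : ∑ j ∈ Finset.range m, y j = 0) (p : ℝ) :
    2 * p * ∑ i ∈ Finset.range m, p ^ i * autocorrelation m y (i + 1)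
      = (1 - p) ^ 2 * ∑ i ∈ Finset.range m, windowSquareSum m y (i + 1) * p ^ i
        - (1 - p ^ m) * windowSquareSum m y 1 := by
  have h := geom_sum_second_difference (windowSquareSum m y) p m
  simp only [windowSquareSum_second_difference hy, windowSquareSum_zero,
    windowSquareSum_period hy hy0, windowSquareSum_period_add_one hy hy0] at h
  have e : p * ∑ i ∈ Finset.range m, p ^ i * (2 * autocorrelation m y (i + 1))
      = 2 * p * ∑ i ∈ Finset.range m, p ^ i * autocorrelation m y (i + 1) := by
    rw [mul_comm 2 p, mul_assoc, Finset.mul_sum (Finset.range m) _ 2]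
    congr 1
    exact Finset.sum_congr rfl fun i _ => by ring
  rw [← e, h]
  ring

/-- The sum over a period of `y j * w (j + 1)`, where `w j = y j + p * w (j + 1)` up to the scale
`z`. -/
theorem sum_mul_backward_recursion {w : ℕ → ℝ} {z p : ℝ} (hw : Function.Periodic w m)
    (hrec : ∀ j, w j = z * y j + p * w (j + 1)) :
    (1 - p ^ m) * ∑ j ∈ Finset.range m, y j * w (j + 1)
      = z * ∑ i ∈ Finset.range m, p ^ i * autocorrelation m y (i + 1) := by
  -- The recursion is unrolled `n` times; for `n = m`, periodicity makes the remainder `p ^ m` times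
  -- the original sum.
  have key : ∀ n, ∑ j ∈ Finset.range m, y j * w (j + 1)
      = z * ∑ i ∈ Finset.range n, p ^ i * autocorrelation m y (i + 1)
        + p ^ n * ∑ j ∈ Finset.range m, y j * w (j + (n + 1)) := by
    intro n
    induction n with
    | zero => simp
    | succ n ih =>
      have e : ∑ j ∈ Finset.range m, y j * w (j + (n + 1))
          = z * autocorrelation m y (n + 1)
            + p * ∑ j ∈ Finset.range m, y j * w (j + (n + 1 + 1)) := by
        rw [autocorrelation, Finset.mul_sum, Finset.mul_sum, ← Finset.sum_add_distrib]
        refine Finset.sum_congr rfl fun j _ => ?_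
        rw [hrec (j + (n + 1)), add_assoc j (n + 1) 1]
        ring
      rw [ih, e, Finset.sum_range_succ]
      ring
  have h := key m
  have e : ∑ j ∈ Finset.range m, y j * w (j + (m + 1)) = ∑ j ∈ Finset.range m, y j * w (j + 1) :=
    Finset.sum_congr rfl fun j _ => by
      rw [← add_assoc, add_right_comm, hw]
  rw [e] at h
  linarith

/-- Each entry lies in `i` windows, so the window sums total `i * m * a`; this gives the correction
`m * a ^ 2 * i ^ 2`. -/
theorem windowSquareSum_sub_const {r : ℕ → ℝ} (hr : Function.Periodic r m) {a : ℝ}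
    (ha : ∑ j ∈ Finset.range m, r j = m * a) (i : ℕ) :
    windowSquareSum m (fun j => r j - a) i = windowSquareSum m r i - m * a ^ 2 * (i : ℝ) ^ 2 := by
  have hsum : ∑ j ∈ Finset.range m, ∑ k ∈ Finset.range i, r (j + k) = i * (m * a) := by
    rw [Finset.sum_comm]
    simp only [hr.sum_shift, ha]
    simp
  have e : ∀ j, (∑ k ∈ Finset.range i, (r (j + k) - a)) ^ 2
      = (∑ k ∈ Finset.range i, r (j + k)) ^ 2 - 2 * i * a * ∑ k ∈ Finset.range i, r (j + k)
        + (i * a) ^ 2 := fun j => by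
    rw [Finset.sum_sub_distrib]
    simp only [Finset.sum_const, Finset.card_range, nsmul_eq_mul]
    ring
  simp only [windowSquareSum, e]
  rw [Finset.sum_add_distrib, Finset.sum_sub_distrib, ← Finset.mul_sum, hsum]
  simp only [Finset.sum_const, Finset.card_range, nsmul_eq_mul]
  ring

/-- The cost of a period, where `W j` is the expected time from the start of the `j`-th block to
the next reception. -/
theorem sum_block_cost {r W : ℕ → ℝ} (hm : m ≠ 0) (hr : Function.Periodic r m)
    (hW : Function.Periodic W m)
    {p x z a s : ℝ} (hp0 : 0 ≤ p) (hp1 : p < 1) (ha : ∑ j ∈ Finset.range m, r j = m * a)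
    (hs : s = a * z + x)
    (hrec : ∀ j, W j = x + z * r j + p * W (j + 1)) :
    ∑ j ∈ Finset.range m, (x * W j + z ^ 2 * (r j * (r j - 1) / 2)
        + z * r j * (x + p * W (j + 1)))
      = m * s ^ 2 * (1 + p) / (2 * (1 - p))
        + z ^ 2 * (1 - p) ^ 2 / (2 * (1 - p ^ m)) *
          ∑ i ∈ Finset.range m, (windowSquareSum m r (i + 1)
            - m * a ^ 2 * ((i + 1 : ℕ) : ℝ) ^ 2) * p ^ i
        + m * x * s - m * (x ^ 2 + a * z ^ 2) / 2 := by
  have hp : 1 - p ≠ 0 := by linarith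
  have hpm : 1 - p ^ m ≠ 0 := by linarith [pow_lt_one₀ hp0 hp1 hm]
  let y : ℕ → ℝ := fun j => r j - a
  -- `s / (1 - p)` is the fixed point of the recursion of `W` when every `r j` equals `a`.
  let w : ℕ → ℝ := fun j => W j - s / (1 - p)
  have hy : Function.Periodic y m := fun j => by simp only [y, hr j]
  have hw : Function.Periodic w m := fun j => by simp only [w, hW j]
  have hy0 : ∑ j ∈ Finset.range m, y j = 0 := by
    simp [y, Finset.sum_sub_distrib, ha]
  have hwrec : ∀ j, w j = z * y j + p * w (j + 1) := fun j => by
    simp only [w, y, hrec j, hs]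
    field_simp
    ring
  have hw0 : ∑ j ∈ Finset.range m, w (j + 1) = 0 := by
    have h1 : ∑ j ∈ Finset.range m, w j
        = z * ∑ j ∈ Finset.range m, y j + p * ∑ j ∈ Finset.range m, w (j + 1) := by
      rw [Finset.mul_sum, Finset.mul_sum, ← Finset.sum_add_distrib]
      exact Finset.sum_congr rfl fun j _ => hwrec j
    rw [hy0, hw.sum_shift] at h1
    rw [hw.sum_shift]
    have h2 : (1 - p) * ∑ j ∈ Finset.range m, w j = 0 := by linarith
    exact (mul_eq_zero.1 h2).resolve_left hp
  have hQ := sum_mul_backward_recursion (y := y) hw hwrec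
  have hA := geom_sum_autocorrelation hy hy0 p
  have hd : ∀ i, windowSquareSum m r i - m * a ^ 2 * (i : ℝ) ^ 2 = windowSquareSum m y i :=
    fun i => (windowSquareSum_sub_const hr ha i).symm
  simp only [hd]
  set D := ∑ i ∈ Finset.range m, windowSquareSum m y (i + 1) * p ^ i
  set Q := ∑ j ∈ Finset.range m, y j * w (j + 1)
  set E := ∑ i ∈ Finset.range m, p ^ i * autocorrelation m y (i + 1)
  rw [windowSquareSum_one] at hA
  set Y := ∑ j ∈ Finset.range m, y j ^ 2
  -- In centred variables the terms linear in `y` or `w` sum to zero over a period.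
  have hterm : ∀ j, x * W j + z ^ 2 * (r j * (r j - 1) / 2) + z * r j * (x + p * W (j + 1))
      = z ^ 2 / 2 * y j ^ 2 + p * z * (y j * w (j + 1)) + p * s * w (j + 1)
        + (z ^ 2 * a - z ^ 2 / 2 + 2 * x * z + p * z * (s / (1 - p))) * y j
        + (x ^ 2 + 2 * x * z * a + z ^ 2 * (a ^ 2 - a) / 2 + p * s * (s / (1 - p))) := fun j => by
    have e1 : W (j + 1) = w (j + 1) + s / (1 - p) := by simp only [w]; ring
    have e2 : r j = y j + a := by simp only [y]; ring
    rw [hrec j, e1, e2, hs]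
    ring
  have hS : ∑ j ∈ Finset.range m, (x * W j + z ^ 2 * (r j * (r j - 1) / 2)
        + z * r j * (x + p * W (j + 1)))
      = z ^ 2 / 2 * Y + p * z * Q
        + m * (x ^ 2 + 2 * x * z * a + z ^ 2 * (a ^ 2 - a) / 2 + p * s * (s / (1 - p))) := by
    simp only [hterm]
    rw [Finset.sum_add_distrib, Finset.sum_add_distrib, Finset.sum_add_distrib,
      Finset.sum_add_distrib, ← Finset.mul_sum, ← Finset.mul_sum, ← Finset.mul_sum,
      ← Finset.mul_sum, hw0, hy0]
    simp [Y, Q]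
    ring
  have hQ' : Q = z * E / (1 - p ^ m) := by
    rw [eq_div_iff hpm]; linarith
  -- The term `- z ^ 2 / 2 * Y` cancels the square term of `hS`.
  have hE : p * z * (z * E / (1 - p ^ m))
      = z ^ 2 * (1 - p) ^ 2 / (2 * (1 - p ^ m)) * D - z ^ 2 / 2 * Y := by
    have h3 : p * z * (z * E / (1 - p ^ m)) = z ^ 2 * (2 * p * E) / (2 * (1 - p ^ m)) := by
      field_simp
    rw [h3, hA]
    field_simp
  rw [hS, hQ', hE, hs]
  field_simp
  ring

end Window

theorem cyclicSquareSum_eq_windowSquareSum {m : ℕ} {r : ℕ → ℕ} (hr : Function.Periodic r m)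
    (i : ℕ) : cyclicSquareSum m r i = windowSquareSum m (fun k => (r k : ℝ)) i := by
  refine Finset.sum_congr rfl fun j _ => ?_
  rw [Finset.sum_Ico_eq_sum_range, Nat.add_sub_cancel_left]
  simp only [hr.map_mod_nat]

/-! ### The scheduling instances of a source -/

theorem appearances_pos {K N : ℕ} {P : Fin K → Fin N} {n : Fin N} (hn : ∃ k, P k = n) : 0 < appearances P n := by
  obtain ⟨k₀, hk₀⟩ := hn
  exact Finset.card_pos.2 ⟨k₀, by simp [hk₀]⟩

theorem appearances_add {K : ℕ} {P : Fin K → Fin 2} {n o : Fin 2} (hno : n ≠ o) : appearances P n + appearances P o = K := by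
  have : (Finset.univ.filter fun k : Fin K => P k = o)
      = Finset.univ.filter fun k : Fin K => ¬ P k = n := by
    ext k
    simp only [Finset.mem_filter, Finset.mem_univ, true_and]
    omega
  rw [appearances, appearances, this, Finset.card_filter_add_card_filter_not]
  simp

section Schedule

variable {K N : ℕ} [NeZero K] {P : Fin K → Fin N} {n : Fin N}

theorem appearances_eq_count [DecidablePred fun k => sched P k = n] :
    appearances P n = Nat.count (fun k => sched P k = n) K := by
  rw [Nat.count_eq_card_filter_range, appearances, Finset.card_filter, Finset.card_filter,
    ← Fin.sum_univ_eq_sum_range (fun k => if sched P k = n then 1 else 0)]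
  simp only [sched_val]

theorem infinite_sched (hn : ∃ k, P k = n) : (Set.ofPred fun k => sched P k = n).Infinite := by
  obtain ⟨k₀, hk₀⟩ := hn
  refine Set.infinite_of_forall_exists_gt fun i => ⟨k₀ + (i + 1) * K, ?_, ?_⟩
  · show sched P _ = n
    have := (sched_periodic (P := P)).nat_mul (i + 1) k₀
    simp only [Nat.cast_id] at this
    rw [this, sched_val, hk₀]
  · have := Nat.le_mul_of_pos_right (i + 1) (Nat.pos_of_ne_zero (NeZero.ne K))
    omega

theorem sched_instanceIndex (hn : ∃ k, P k = n) (j : ℕ) : sched P (instanceIndex P n j) = n :=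
  Nat.nth_mem_of_infinite (infinite_sched hn) j

theorem instanceIndex_strictMono (hn : ∃ k, P k = n) : StrictMono (instanceIndex P n) :=
  Nat.nth_strictMono (infinite_sched hn)

/-- Moving on by one period `K` raises the count of instances of `n` by `appearances P n`. -/
theorem instanceIndex_add_appearances (hn : ∃ k, P k = n) (j : ℕ) :
    instanceIndex P n (j + appearances P n) = instanceIndex P n j + K := by
  classical
  have h1 : sched P (instanceIndex P n j + K) = n := by
    rw [sched_periodic, sched_instanceIndex hn]
  have h2 : Nat.count (fun k => sched P k = n) (instanceIndex P n j + K)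
      = j + appearances P n := by
    rw [Nat.count_add', ← appearances_eq_count]
    simp only [sched_periodic _]
    rw [instanceIndex, Nat.count_nth_of_infinite (infinite_sched hn)]
  have h3 := Nat.nth_count (p := fun k => sched P k = n) h1
  rwa [h2] at h3

theorem sched_ne_of_mem_Ioo (hn : ∃ k, P k = n) {j k : ℕ}
    (hk : k ∈ Finset.Ioo (instanceIndex P n j) (instanceIndex P n (j + 1))) : sched P k ≠ n := by
  classical
  intro h
  obtain ⟨h1, h2⟩ := Finset.mem_Ioo.1 hk
  have h3 : instanceIndex P n (Nat.count (fun k => sched P k = n) k) = k :=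
    Nat.nth_count (p := fun k => sched P k = n) h
  rw [← h3] at h1 h2
  have h4 := (instanceIndex_strictMono hn).lt_iff_lt.1 h1
  have h5 := (instanceIndex_strictMono hn).lt_iff_lt.1 h2
  omega

theorem placement_eq_card (hn : ∃ k, P k = n) (j : ℕ) :
    placement P n j = (Finset.Ioo (instanceIndex P n j) (instanceIndex P n (j + 1))).card := by
  rw [placement, Finset.filter_true_of_mem fun k hk => sched_ne_of_mem_Ioo hn hk]

theorem instanceIndex_succ (hn : ∃ k, P k = n) (j : ℕ) :
    instanceIndex P n (j + 1) = instanceIndex P n j + 1 + placement P n j := by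
  have := instanceIndex_strictMono hn (Nat.lt_succ_self j)
  rw [placement_eq_card hn, Nat.card_Ioo]
  simp only [Nat.succ_eq_add_one] at this
  omega

theorem placement_periodic (hn : ∃ k, P k = n) :
    Function.Periodic (placement P n) (appearances P n) := fun j => by
  have h1 := instanceIndex_succ hn (j + appearances P n)
  have h2 := instanceIndex_succ hn j
  rw [add_right_comm, instanceIndex_add_appearances hn, instanceIndex_add_appearances hn] at h1
  omega

/-- Summing over a repetition of the pattern block by block, each block starting with a scheduling
instance of source `n`. -/
theorem sum_period_eq_sum_blocks (hn : ∃ k, P k = n) {f : ℕ → ℝ} (hf : Function.Periodic f K) :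
    ∑ k ∈ Finset.range K, f k = ∑ j ∈ Finset.range (appearances P n), (f (instanceIndex P n j)
      + ∑ i ∈ Finset.range (placement P n j), f (instanceIndex P n j + 1 + i)) := by
  -- The blocks tile a window of length `K` that starts at the first instance of `n`, not
  -- necessarily at `0`; periodicity of `f` removes this offset.
  have key : ∀ m, ∑ k ∈ Finset.Ico (instanceIndex P n 0) (instanceIndex P n m), f k
      = ∑ j ∈ Finset.range m, (f (instanceIndex P n j)
      + ∑ i ∈ Finset.range (placement P n j), f (instanceIndex P n j + 1 + i)) := by
    intro m
    induction m with
    | zero => simp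
    | succ m ih =>
      have hlt := instanceIndex_strictMono hn (Nat.lt_succ_self m)
      rw [Finset.sum_range_succ, ← ih, ← Finset.sum_Ico_consecutive f
        ((instanceIndex_strictMono hn).monotone (Nat.zero_le m)) hlt.le,
        Finset.sum_eq_sum_Ico_succ_bot hlt, Finset.sum_Ico_eq_sum_range f (_ + 1), Nat.succ_eq_add_one,
        instanceIndex_succ hn, Nat.add_sub_cancel_left]
  have h0 := instanceIndex_add_appearances hn 0
  rw [zero_add] at h0
  rw [← key, h0, Finset.sum_Ico_eq_sum_range, Nat.add_sub_cancel_left, hf.sum_range_add]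

theorem sum_placement (hn : ∃ k, P k = n) :
    appearances P n + ∑ j ∈ Finset.range (appearances P n), placement P n j = K := by
  have h := sum_period_eq_sum_blocks hn (f := fun _ => 1) fun _ => rfl
  simp only [Finset.sum_const, Finset.card_range, nsmul_eq_mul, mul_one,
    Finset.sum_add_distrib] at h
  exact_mod_cast h.symm

end Schedule

/-! ### Two sources: solving the Poisson equation block by block -/

section TwoSources

variable {K : ℕ} [NeZero K] {P : Fin K → Fin 2} {n o : Fin 2}

theorem sched_eq_other (hno : n ≠ o) {k : ℕ} (h : sched P k ≠ n) : sched P k = o := by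
  omega

theorem sched_instanceIndex_add (hn : ∃ k, P k = n) (hno : n ≠ o) {j i : ℕ}
    (hi : i < placement P n j) : sched P (instanceIndex P n j + 1 + i) = o := by
  refine sched_eq_other hno (sched_ne_of_mem_Ioo hn (j := j)
    (Finset.mem_Ioo.2 ⟨by omega, ?_⟩))
  rw [instanceIndex_succ hn]
  omega

theorem sum_placement_eq (hn : ∃ k, P k = n) (hno : n ≠ o) :
    ∑ j ∈ Finset.range (appearances P n), (placement P n j : ℝ)
      = appearances P n * ((appearances P o : ℝ) / appearances P n) := by
  have h1 := sum_placement hn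
  have h2 := appearances_add (P := P) hno
  have h3 : ∑ j ∈ Finset.range (appearances P n), placement P n j = appearances P o := by omega
  have h4 : (appearances P n : ℝ) ≠ 0 := by exact_mod_cast (appearances_pos hn).ne'
  rw [mul_div_cancel₀ _ h4, ← h3]
  push_cast
  rfl

theorem sum_period_eq (hn : ∃ k, P k = n) (hno : n ≠ o) (g : Fin 2 → ℝ) :
    ∑ k ∈ Finset.range K, g (sched P k)
      = appearances P n * (g n + (appearances P o : ℝ) / appearances P n * g o) := by
  rw [sum_period_eq_sum_blocks hn (f := fun k => g (sched P k))
    fun k => by simp only [sched_periodic k]]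
  have : ∀ j, g (sched P (instanceIndex P n j))
      + ∑ i ∈ Finset.range (placement P n j), g (sched P (instanceIndex P n j + 1 + i))
      = g n + placement P n j * g o := fun j => by
    rw [sched_instanceIndex hn, Finset.sum_congr rfl fun i hi => by
      rw [sched_instanceIndex_add hn hno (Finset.mem_range.1 hi)]]
    simp
  simp only [this]
  rw [Finset.sum_add_distrib, ← Finset.sum_mul, sum_placement_eq hn hno]
  simp only [Finset.sum_const, Finset.card_range, nsmul_eq_mul]
  ring

theorem sum_range_id_real (m : ℕ) : ∑ i ∈ Finset.range m, ((i : ℝ) + 1) = m * (m + 1) / 2 := by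
  induction m with
  | zero => simp
  | succ m ih => rw [Finset.sum_range_succ, ih]; push_cast; ring

/-- The solution of the Poisson equation, summed over a repetition of the pattern. -/
theorem sum_poisson_solution (hn : ∃ k, P k = n) (hno : n ≠ o) {c : ℕ → ℝ} {g : Fin 2 → ℝ}
    {p : ℝ} (hp0 : 0 ≤ p) (hp1 : p < 1) (hcK : Function.Periodic c K)
    (hc : ∀ k, c k = g (sched P k) + (if sched P k = n then p else 1) * c (k + 1)) {a s : ℝ}
    (ha : a = (appearances P o : ℝ) / appearances P n) (hs : s = a * g o + g n) :
    ∑ k ∈ Finset.range K, c (k + 1) * g (sched P k)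
      = appearances P n * s ^ 2 * (1 + p) / (2 * (1 - p))
        + g o ^ 2 * (1 - p) ^ 2 / (2 * (1 - p ^ appearances P n)) *
          ∑ i ∈ Finset.Icc 1 (appearances P n),
            (cyclicSquareSum (appearances P n) (placement P n) i
              - appearances P n * a ^ 2 * (i : ℝ) ^ 2) * p ^ (i - 1)
        + appearances P n * g n * s - appearances P n * (g n ^ 2 + a * g o ^ 2) / 2 := by
  set α := appearances P n with hα
  have hα0 : α ≠ 0 := (appearances_pos hn).ne'
  let W : ℕ → ℝ := fun j => c (instanceIndex P n j + 1)
  have hWα : Function.Periodic W α := fun j => by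
    simp only [W]
    rw [instanceIndex_add_appearances hn, add_right_comm, hcK]
  -- Inside a block only the other source transmits, nothing is reset, and `c` decreases by `g o` at
  -- each transmission.
  have hstep : ∀ j i, i ≤ placement P n j →
      c (instanceIndex P n j + 1 + i) = W j - i * g o := by
    intro j i
    induction i with
    | zero => intro _; simp [W]
    | succ i ih =>
      intro hi
      have h1 := ih (by omega)
      have h2 := sched_instanceIndex_add hn hno (Nat.lt_of_succ_le hi)
      rw [hc, h2, if_neg hno.symm, one_mul] at h1
      rw [← add_assoc]
      push_cast
      linarith
  have hinst : ∀ j, c (instanceIndex P n j) = g n + p * W j := fun j => by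
    rw [hc, sched_instanceIndex hn, if_pos rfl]
  have hrec : ∀ j, W j = g n + g o * placement P n j + p * W (j + 1) := fun j => by
    have h1 := hstep j _ le_rfl
    rw [← instanceIndex_succ hn, hinst] at h1
    linarith
  have hblock : ∀ j, c (instanceIndex P n j + 1) * g (sched P (instanceIndex P n j))
      + ∑ i ∈ Finset.range (placement P n j), c (instanceIndex P n j + 1 + i + 1)
        * g (sched P (instanceIndex P n j + 1 + i))
      = g n * W j + g o ^ 2 * ((placement P n j : ℝ) * ((placement P n j : ℝ) - 1) / 2)
        + g o * placement P n j * (g n + p * W (j + 1)) := fun j => by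
    have h1 : ∑ i ∈ Finset.range (placement P n j), c (instanceIndex P n j + 1 + i + 1)
        * g (sched P (instanceIndex P n j + 1 + i))
        = ∑ i ∈ Finset.range (placement P n j), (W j * g o - g o ^ 2 * ((i : ℝ) + 1)) := by
      refine Finset.sum_congr rfl fun i hi => ?_
      have hi' := Finset.mem_range.1 hi
      rw [sched_instanceIndex_add hn hno hi', add_assoc _ i 1, hstep j (i + 1) hi']
      push_cast
      ring
    rw [h1, sched_instanceIndex hn, Finset.sum_sub_distrib, ← Finset.mul_sum _ _ (g o ^ 2),
      sum_range_id_real]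
    simp only [Finset.sum_const, Finset.card_range, nsmul_eq_mul]
    have h2 : g n + p * W (j + 1) = W j - g o * placement P n j := by linarith [hrec j]
    rw [h2]
    simp only [W]
    ring
  rw [sum_period_eq_sum_blocks hn (f := fun k => c (k + 1) * g (sched P k)) (fun k => by
    simp only [sched_periodic k, add_right_comm k K 1, hcK (k + 1)])]
  simp only [hblock]
  have hr : Function.Periodic (fun j => (placement P n j : ℝ)) α := fun j => by
    simp only [placement_periodic hn j, hα]
  have hsum := sum_block_cost hα0 hr hWα hp0 hp1 (ha ▸ sum_placement_eq hn hno) hs hrec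
  rw [hsum, ← Finset.Ico_add_one_right_eq_Icc, Finset.sum_Ico_eq_sum_range, Nat.add_sub_cancel]
  simp only [cyclicSquareSum_eq_windowSquareSum (placement_periodic hn), add_comm 1,
    Nat.add_sub_cancel, hα]

end TwoSources

/-! ### The mean age of a source -/

namespace IsCyclicTransmission

variable {Ω : Type*} [MeasurableSpace Ω] {μ : Measure Ω} [IsProbabilityMeasure μ]
  {K : ℕ} [NeZero K] {P : Fin K → Fin 2} {F : Fin 2 → Measure ℝ} {p : Fin 2 → ℝ}
  {S : ℕ → Ω → ℝ} {X : ℕ → Ω → Bool} {n o : Fin 2}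

theorem secondMoment_eq (hmodel : IsCyclicTransmission P μ F p S X) (hn : ∃ k, P k = n) :
    ∫ x, x ^ 2 ∂F n = variance (fun x => x) (F n) + (∫ x, x ∂F n) ^ 2 := by
  obtain ⟨k, rfl⟩ := hn
  have hlaw := hmodel.service_law k
  rw [sched_val] at hlaw
  have : IsProbabilityMeasure (F (P k)) :=
    hlaw.map_eq ▸ Measure.isProbabilityMeasure_map hlaw.aemeasurable
  have h := variance_eq_sub (hmodel.service_memLp (P k))
  rw [h]
  simp

theorem variance_service (hmodel : IsCyclicTransmission P μ F p S X) (k : ℕ) :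
    variance (S k) μ = variance (fun x => x) (F (sched P k)) := by
  have hk : ∃ i, P i = sched P k := ⟨_, rfl⟩
  rw [variance_eq_sub (hmodel.memLp_service k)]
  have h1 := hmodel.secondMoment_eq hk
  have h2 := hmodel.integral_service_sq k
  simp only [Pi.pow_apply]
  rw [h2, h1, hmodel.integral_service]
  ring

theorem integral_gapTime (hmodel : IsCyclicTransmission P μ F p S X) (hn : ∃ k, P k = n)
    (hno : n ≠ o) (j : ℕ) :
    ∫ ω, gapTime P S n j ω ∂μ = placement P n j * ∫ x, x ∂F o := by
  simp only [gapTime]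
  rw [integral_finsetSum _ fun k _ => (hmodel.memLp_service k).integrable one_le_two]
  rw [Finset.sum_congr rfl fun k hk => by
    rw [hmodel.integral_service, sched_eq_other hno (sched_ne_of_mem_Ioo hn hk)]]
  rw [Finset.sum_const, ← placement_eq_card hn, nsmul_eq_mul]

theorem integral_gapTime_sq (hmodel : IsCyclicTransmission P μ F p S X) (hn : ∃ k, P k = n)
    (hno : n ≠ o) (j : ℕ) :
    ∫ ω, gapTime P S n j ω ^ 2 ∂μ = placement P n j * variance (fun x => x) (F o)
      + (placement P n j : ℝ) ^ 2 * (∫ x, x ∂F o) ^ 2 := by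
  have hmem : MemLp (gapTime P S n j) 2 μ := memLp_finsetSum _ fun k _ => hmodel.memLp_service k
  have h1 := variance_eq_sub hmem
  have h2 : variance (gapTime P S n j) μ
      = placement P n j * variance (fun x => x) (F o) := by
    have e : gapTime P S n j
        = ∑ k ∈ Finset.Ioo (instanceIndex P n j) (instanceIndex P n (j + 1)), S k := by
      ext ω; simp [gapTime]
    rw [e, IndepFun.variance_sum (fun k _ => hmodel.memLp_service k)
      fun i _ k _ hik => hmodel.indepFun_service hik]
    rw [Finset.sum_congr rfl fun k hk => by
      rw [hmodel.variance_service, sched_eq_other hno (sched_ne_of_mem_Ioo hn hk)]]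
    rw [Finset.sum_const, ← placement_eq_card hn, nsmul_eq_mul]
  have h3 : ∫ ω, gapTime P S n j ω ^ 2 ∂μ = variance (gapTime P S n j) μ
      + (∫ ω, gapTime P S n j ω ∂μ) ^ 2 := by
    rw [h1]; simp
  rw [h3, h2, hmodel.integral_gapTime hn hno]
  ring

theorem gapMoment_one (hmodel : IsCyclicTransmission P μ F p S X) (hn : ∃ k, P k = n)
    (hno : n ≠ o) :
    gapMoment P μ S n 1 = (appearances P o : ℝ) / appearances P n * ∫ x, x ∂F o := by
  have h : (appearances P n : ℝ) ≠ 0 := by exact_mod_cast (appearances_pos hn).ne'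
  simp only [gapMoment, pow_one, hmodel.integral_gapTime hn hno]
  rw [← Finset.sum_mul, sum_placement_eq hn hno]
  field_simp

/-- The sum of the squared placement entries is `r̃(1)`, the only window term of the age formula
left when `p n = 0`. -/
theorem gapMoment_two (hmodel : IsCyclicTransmission P μ F p S X) (hn : ∃ k, P k = n)
    (hno : n ≠ o) :
    gapMoment P μ S n 2
      = (appearances P o : ℝ) / appearances P n * variance (fun x => x) (F o)
        + cyclicSquareSum (appearances P n) (placement P n) 1 / appearances P n
          * (∫ x, x ∂F o) ^ 2 := by
  have h : (appearances P n : ℝ) ≠ 0 := by exact_mod_cast (appearances_pos hn).ne'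
  simp only [gapMoment, hmodel.integral_gapTime_sq hn hno]
  rw [Finset.sum_add_distrib, ← Finset.sum_mul, ← Finset.sum_mul, sum_placement_eq hn hno,
    cyclicSquareSum_eq_windowSquareSum (placement_periodic hn), windowSquareSum_one]
  field_simp

/-- Stated for an arbitrary ordered pair of distinct sources, so that it can be used in both
directions. -/
theorem hasMeanAoI_of_two_sources (hmodel : IsCyclicTransmission P μ F p S X)
    (hn : ∃ k, P k = n) (ho : ∃ k, P k = o) (hno : n ≠ o) (hp : ∀ m, 0 ≤ p m ∧ p m < 1)
    {δ : Fin 2 → Ω → ℝ} (hδ : ∀ ω, 0 ≤ δ n ω) {sn so vn vo a s v : ℝ} {α : ℕ}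
    (hsn : sn = ∫ x, x ∂F n) (hso : so = ∫ x, x ∂F o) (hsn0 : 0 < sn) (hso0 : 0 < so)
    (hvn : vn = variance (fun x => x) (F n)) (hvo : vo = variance (fun x => x) (F o))
    (hα : α = appearances P n) (ha : a = (appearances P o : ℝ) / α) (hs : s = a * so + sn)
    (hv : v = a * vo + vn) :
    ∃ E : ℝ, HasMeanAoI P μ S X δ n E ∧
      E = (1 + p n) / (2 * (1 - p n)) * s + v / (2 * s) + sn
        + so ^ 2 * ((1 - p n) ^ 2 / (2 * s * α * (1 - p n ^ α))) *
          ∑ i ∈ Finset.Icc 1 α,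
            (cyclicSquareSum α (placement P n) i - α * a ^ 2 * (i : ℝ) ^ 2) * p n ^ (i - 1) ∧
      (p n = 0 → E = noDropAoI sn (∫ x, x ^ 2 ∂F n) (gapMoment P μ S n 1)
        (gapMoment P μ S n 2)) := by
  subst hα
  have hα0 : (0 : ℝ) < appearances P n := by exact_mod_cast appearances_pos hn
  have hβ0 : (0 : ℝ) < appearances P o := by exact_mod_cast appearances_pos ho
  have ha0 : 0 < a := ha ▸ div_pos hβ0 hα0
  have hs0 : 0 < s := by rw [hs]; positivity
  have hσ : ∑ k ∈ Finset.range K, ∫ x, x ∂F (sched P k) = appearances P n * s := by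
    rw [sum_period_eq hn hno fun m => ∫ x, x ∂F m, ← hsn, ← hso, ← ha, hs]
    ring
  have hq : ∑ k ∈ Finset.range K, (∫ x, x ^ 2 ∂F (sched P k)) / 2
      = appearances P n * ((vn + sn ^ 2) / 2 + a * ((vo + so ^ 2) / 2)) := by
    rw [sum_period_eq hn hno fun m => (∫ x, x ^ 2 ∂F m) / 2, ← ha, hmodel.secondMoment_eq hn,
      hmodel.secondMoment_eq ho, ← hsn, ← hso, ← hvn, ← hvo]
  obtain ⟨c, hcK, hc, hmean⟩ := hmodel.hasMeanAoI hδ hn hp (hσ ▸ mul_pos hα0 hs0)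
  have hcost := sum_poisson_solution hn hno (g := fun m => ∫ x, x ∂F m) (hp n).1 (hp n).2 hcK hc
    ha (hso ▸ hsn ▸ hs)
  simp only [← hsn, ← hso] at hcost
  rw [hσ, hq, hcost] at hmean
  have hpn : (1 - p n) ≠ 0 := by linarith [(hp n).2]
  have hpα : (1 - p n ^ appearances P n) ≠ 0 := by
    linarith [pow_lt_one₀ (hp n).1 (hp n).2 (appearances_pos hn).ne']
  refine ⟨_, hmean, ?_, fun hp0 => ?_⟩
  · set D := ∑ i ∈ Finset.Icc 1 (appearances P n),
      (cyclicSquareSum (appearances P n) (placement P n) i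
        - appearances P n * a ^ 2 * (i : ℝ) ^ 2) * p n ^ (i - 1)
    rw [hv]
    field_simp
    ring
  · have hD : ∑ i ∈ Finset.Icc 1 (appearances P n),
        (cyclicSquareSum (appearances P n) (placement P n) i
          - appearances P n * a ^ 2 * (i : ℝ) ^ 2) * p n ^ (i - 1)
        = cyclicSquareSum (appearances P n) (placement P n) 1 - appearances P n * a ^ 2 := by
      -- Only `i = 1` survives, because `0 ^ 0 = 1`.
      rw [Finset.sum_eq_single_of_mem 1 (Finset.mem_Icc.2 ⟨le_rfl, appearances_pos hn⟩)
        fun i hi hi1 => by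
          have := (Finset.mem_Icc.1 hi).1
          rw [hp0, zero_pow (by omega), mul_zero]]
      simp
    rw [hD, hp0, zero_pow (appearances_pos hn).ne', noDropAoI, hmodel.gapMoment_one hn hno,
      hmodel.gapMoment_two hn hno, hmodel.secondMoment_eq hn, ← hsn, ← hso, ← hvn, ← hvo, ← ha,
      add_comm sn, ← hs]
    field_simp
    rw [hs]
    ring

end IsCyclicTransmission

theorem mainTheorem3
    {Ω : Type*} [MeasurableSpace Ω] (μ : Measure Ω) [IsProbabilityMeasure μ]
    {K : ℕ} [NeZero K] (P : Fin K → Fin 2) (hP : Function.Surjective P)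
    (F : Fin 2 → Measure ℝ) (p : Fin 2 → ℝ) (hp : ∀ n, 0 ≤ p n ∧ p n < 1)
    (S : ℕ → Ω → ℝ) (X : ℕ → Ω → Bool) (hmodel : IsCyclicTransmission P μ F p S X)
    (δ : Fin 2 → Ω → ℝ) (hδ : ∀ n ω, 0 ≤ δ n ω)
    (s₁ s₂ v₁ v₂ : ℝ) (hs₁ : s₁ = ∫ x, x ∂F 0) (hs₂ : s₂ = ∫ x, x ∂F 1)
    (hs₁_pos : 0 < s₁) (hs₂_pos : 0 < s₂)
    (hv₁ : v₁ = variance (fun x => x) (F 0)) (hv₂ : v₂ = variance (fun x => x) (F 1))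
    (α₁ α₂ : ℕ) (hα₁ : α₁ = appearances P 0) (hα₂ : α₂ = appearances P 1)
    (a s v : ℝ) (ha : a = (α₂ : ℝ) / (α₁ : ℝ)) (hs : s = a * s₂ + s₁) (hv : v = a * v₂ + v₁) :
    ∃ EΔ₁ EΔ₂ : ℝ,
      HasMeanAoI P μ S X δ 0 EΔ₁ ∧ HasMeanAoI P μ S X δ 1 EΔ₂ ∧
      EΔ₁ = (1 + p 0) / (2 * (1 - p 0)) * s + v / (2 * s) + s₁ +
        s₂ ^ 2 * ((1 - p 0) ^ 2 / (2 * s * α₁ * (1 - p 0 ^ α₁))) *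
          ∑ i ∈ Finset.Icc 1 α₁,
            (cyclicSquareSum α₁ (placement P 0) i - α₁ * a ^ 2 * (i : ℝ) ^ 2) * p 0 ^ (i - 1) ∧
      EΔ₂ = (1 + p 1) / (2 * a * (1 - p 1)) * s + v / (2 * s) + s₂ +
        s₁ ^ 2 * (a * (1 - p 1) ^ 2 / (2 * s * α₂ * (1 - p 1 ^ α₂))) *
          ∑ i ∈ Finset.Icc 1 α₂,
            (cyclicSquareSum α₂ (placement P 1) i - α₂ * (i : ℝ) ^ 2 / a ^ 2) * p 1 ^ (i - 1) ∧
      (p 0 = 0 → EΔ₁ = noDropAoI s₁ (∫ x, x ^ 2 ∂F 0) (gapMoment P μ S 0 1) (gapMoment P μ S 0 2)) ∧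
      (p 1 = 0 → EΔ₂ = noDropAoI s₂ (∫ x, x ^ 2 ∂F 1) (gapMoment P μ S 1 1) (gapMoment P μ S 1 2)) := by

  subst hα₁ hα₂
  have h0 : ∃ k, P k = 0 := hP 0
  have h1 : ∃ k, P k = 1 := hP 1
  have hα₁0 : (0 : ℝ) < appearances P 0 := by exact_mod_cast appearances_pos h0
  have hα₂0 : (0 : ℝ) < appearances P 1 := by exact_mod_cast appearances_pos h1
  have ha0 : 0 < a := ha ▸ div_pos hα₂0 hα₁0
  have hs0 : 0 < s := by rw [hs]; positivity
  have ha' : a⁻¹ = (appearances P 0 : ℝ) / appearances P 1 := by rw [ha, inv_div]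
  obtain ⟨E₁, hE₁, hf₁, hz₁⟩ := hmodel.hasMeanAoI_of_two_sources h0 h1 (by decide) hp (hδ 0)
    hs₁ hs₂ hs₁_pos hs₂_pos hv₁ hv₂ rfl ha hs hv
  obtain ⟨E₂, hE₂, hf₂, hz₂⟩ := hmodel.hasMeanAoI_of_two_sources h1 h0 (by decide) hp (hδ 1)
    hs₂ hs₁ hs₂_pos hs₁_pos hv₂ hv₁ rfl ha' rfl rfl
  refine ⟨E₁, E₂, hE₁, hE₂, hf₁, ?_, hz₁, hz₂⟩
  -- Exchanging the sources replaces `a`, `s`, `v` by `a⁻¹`, `s / a`, `v / a`.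
  have hsa : a⁻¹ * s₁ + s₂ = s / a := by rw [hs]; field_simp; ring
  have hva : a⁻¹ * v₁ + v₂ = v / a := by rw [hv]; field_simp; ring
  have hp1 : (1 - p 1) ≠ 0 := by linarith [(hp 1).2]
  have hpα : (1 - p 1 ^ appearances P 1) ≠ 0 := by
    linarith [pow_lt_one₀ (hp 1).1 (hp 1).2 (appearances_pos h1).ne']
  rw [hf₂, hsa, hva]
  have hD : ∀ i : ℕ, (appearances P 1 : ℝ) * a⁻¹ ^ 2 * (i : ℝ) ^ 2
      = appearances P 1 * (i : ℝ) ^ 2 / a ^ 2 := fun i => by field_simp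
  simp only [hD]
  congr 1
  · field_simp
  · congr 1
    field_simp
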